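/- Let $d\ge 2$ be an integer, let $0<\kappa<1$ and put $\rho=\kappa^{-1}$. A set $\Omega$ of lines through the origin of $\mathbf{R}^d$ is equiangular with angle $\kappa$ if unit vectors spanning distinct lines of $\Omega$ always have inner product $\pm\kappa$. It saturates the relative bound if $\kappa^2d<1$ and $|\Omega|=\dfrac{d-\kappa^2d}{1-\kappa^2d}$. A set $\Gamma$ of lines is incoherent if $|\Gamma|\le 2$, or $(\alpha_1,\alpha_2)(\alpha_1,\alpha_3)(\alpha_2,\alpha_3)>0$ for unit vectors $\alpha_1,\alpha_2,\alpha_3$ spanning any three distinct lines of $\Gamma$; $\mathrm{Inc}(\Omega)$ is the maximum size of an incoherent subset of $\Omega$. A quasi-symmetric $2$-$(v,k,\lambda;s_1,s_2)$ design is a set of $k$-subsets (blocks) of a $v$-set such that any two distinct points lie in exactly $\lambda$ blocks and such that the sizes of the intersections of two distinct blocks take exactly the two distinct values $s_1$ and $s_2$. Consider the following conditions on a set $\Omega$ of equiangular lines in $\mathbf{R}^d$ with angle $\kappa$. - (i) $d=2$ and $\Omega$ is, up to isometry, the maximal set of $3$ equiangular lines in $\mathbf{R}^2$ (the diagonals joining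 opposite vertices of a regular hexagon); - (ii) $d=3$ and $\Omega$ is, up to isometry, the maximal set of $6$ equiangular lines in $\mathbf{R}^3$ (the diagonals joining opposite vertices of a regular icosahedron); - (iii) $\rho=2i+1$ for an integer $i\ge 1$, $d=\rho(\rho-1)$, $|\Omega|=(\rho^2-1)(\rho-1)$, and there exists a quasi-symmetric $2$-$(2i(2i+1)-1,\,(2i-1)(i+1),\,i(2i^2+i-2);\,i^2+i-1,\,i^2-1)$ design; - (iv) there exists a quasi-symmetric $2$-$(d,k,\lambda;s_1,s_2)$ design, where $k$ is a root of $4x^2-4dx+(\rho-1)^2(d+\rho)$ and $$\lambda=\frac{k(k-1)}{\rho^2-d},\qquad s_1=k-\frac{(\rho-1)^2}{4},\qquad s_2=k-\frac{\rho^2-1}{4}.$$ Then: 1. If $\Omega$ is a set of equiangular lines in $\mathbf{R}^d$ with angle $\kappa$ that saturates the relative bound and $\mathrm{Inc}(\Omega)=d$, then (i), (ii), (iii) or (iv) holds. 2. Conversely, if such a set $\Omega$ satisfies (i) or (ii), then $\mathrm{Inc}(\Omega)=d$. If $d$ and $\rho$ are as in (iii) and the design of (iii) exists, then there exists a set of $(\rho^2-1)(\rho-1)$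 equiangular lines in $\mathbf{R}^d$ with angle $\kappa$ that saturates the relative bound and whose value of $\mathrm{Inc}$ is $d$. If a design as in (iv) exists for $d$ and $\rho$, then there exists a set of equiangular lines in $\mathbf{R}^d$ with angle $\kappa$ that saturates the relative bound and whose value of $\mathrm{Inc}$ is $d$. -/

import Mathlib

open scoped LinearAlgebra.Projectivization

noncomputable section

/-- The lines through the origin in `ℝ^d` (with the Euclidean inner product). -/
abbrev Line (d : ℕ) : Type := ℙ ℝ (EuclideanSpace ℝ (Fin d))

/-- `u` is a unit vector spanning the line `l`. -/
def IsUnitVectorOf {d : ℕ} (u : EuclideanSpace ℝ (Fin d)) (l : Line d) : Prop :=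
  u ∈ l.submodule ∧ ‖u‖ = 1

/-- `Ω` is a set of equiangular lines, `κ` being the cosine of the common angle: unit vectors on
distinct lines of `Ω` have inner product `κ` or `-κ`. -/
def IsEquiangular {d : ℕ} (Ω : Set (Line d)) (κ : ℝ) : Prop :=
  ∀ l ∈ Ω, ∀ m ∈ Ω, l ≠ m → ∀ u v : EuclideanSpace ℝ (Fin d),
    IsUnitVectorOf u l → IsUnitVectorOf v m → |inner ℝ u v| = κ

/-- `Γ` is incoherent: for any three distinct lines in `Γ`, spanned by unit vectors `u, v, w`, the
product `(u,v)(u,w)(v,w)` is positive (the sign does not depend on the choice of the unit vectors).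
A set of at most two lines satisfies this vacuously. -/
def IsIncoherent {d : ℕ} (Γ : Set (Line d)) : Prop :=
  ∀ l ∈ Γ, ∀ m ∈ Γ, ∀ n ∈ Γ, l ≠ m → l ≠ n → m ≠ n →
    ∀ u v w : EuclideanSpace ℝ (Fin d),
      IsUnitVectorOf u l → IsUnitVectorOf v m → IsUnitVectorOf w n →
        0 < (inner ℝ u v : ℝ) * inner ℝ u w * inner ℝ v w

/-- The maximum size of an incoherent subset of `Ω`, as an extended natural number. -/
def Inc {d : ℕ} (Ω : Set (Line d)) : ℕ∞ :=
  ⨆ (Γ : Set (Line d)) (_ : Γ ⊆ Ω ∧ IsIncoherent Γ), Γ.encard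

/-- `Ω` attains the relative bound `(d - κ² d) / (1 - κ² d)`, which is available for `κ² d < 1`. -/
def SaturatesRelativeBound {d : ℕ} (Ω : Set (Line d)) (κ : ℝ) : Prop :=
  κ ^ 2 * d < 1 ∧ Ω.Finite ∧ (Ω.ncard : ℝ) = (d - κ ^ 2 * d) / (1 - κ ^ 2 * d)

/-- `B` is the set of blocks of a `t`-`(v, k, lam)` design on the point set `P`. -/
structure IsDesign {P : Type*} [Fintype P] [DecidableEq P] (t v k lam : ℕ)
    (B : Finset (Finset P)) : Prop where
  card_points : Fintype.card P = v
  card_block : ∀ b ∈ B, b.card = k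
  card_blocks_through : ∀ T : Finset P, T.card = t → (B.filter (fun b => T ⊆ b)).card = lam

/-- `B` is the set of blocks of a quasi-symmetric `t`-`(v, k, lam; s₁, s₂)` design on the point set
`P`: there are exactly two block intersection numbers, namely `s₁` and `s₂`. -/
structure IsQuasiSymmetricDesign {P : Type*} [Fintype P] [DecidableEq P] (t v k lam s₁ s₂ : ℕ)
    (B : Finset (Finset P)) : Prop extends IsDesign t v k lam B where
  ne : s₁ ≠ s₂
  inter : ∀ b ∈ B, ∀ c ∈ B, b ≠ c → (b ∩ c).card = s₁ ∨ (b ∩ c).card = s₂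
  exists_inter_fst : ∃ b ∈ B, ∃ c ∈ B, b ≠ c ∧ (b ∩ c).card = s₁
  exists_inter_snd : ∃ b ∈ B, ∃ c ∈ B, b ≠ c ∧ (b ∩ c).card = s₂

/-- There exists a quasi-symmetric `2`-`(v, k, lam; s₁, s₂)` design. -/
def ExistsQuasiSymmetric2Design (v k lam s₁ s₂ : ℕ) : Prop :=
  ∃ B : Finset (Finset (Fin v)), IsQuasiSymmetricDesign 2 v k lam s₁ s₂ B

/-- The set of lines through the origin that pass through a nonzero point of `X`. -/
def linesThrough {d : ℕ} (X : Set (EuclideanSpace ℝ (Fin d))) : Set (Line d) :=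
  {l | ∃ x ∈ X, x ≠ 0 ∧ x ∈ l.submodule}

/-- The vertices of a regular hexagon centred at the origin. -/
def hexagonVertices : Set (EuclideanSpace ℝ (Fin 2)) :=
  {x | ∃ j : Fin 6,
    x = !₂[Real.cos ((j : ℕ) * (Real.pi / 3)), Real.sin ((j : ℕ) * (Real.pi / 3))]}

/-- The vertices of a regular icosahedron centred at the origin: the cyclic permutations of
`(0, ±1, ±φ)`, where `φ` is the golden ratio. -/
def icosahedronVertices : Set (EuclideanSpace ℝ (Fin 3)) :=
  {x | ∃ a b : ℝ, (a = 1 ∨ a = -1) ∧ (b = Real.goldenRatio ∨ b = -Real.goldenRatio) ∧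
    (x = !₂[0, a, b] ∨ x = !₂[a, b, 0] ∨ x = !₂[b, 0, a])}

/-- `Ω` is, up to isometry, the set of `3` equiangular lines in `ℝ²`, i.e. the lines joining
opposite vertices of a regular hexagon. -/
def IsThreeLinesInPlane {d : ℕ} (Ω : Set (Line d)) : Prop :=
  d = 2 ∧ ∃ f : EuclideanSpace ℝ (Fin 2) ≃ₗᵢ[ℝ] EuclideanSpace ℝ (Fin d),
    Ω = linesThrough (f '' hexagonVertices)

/-- `Ω` is, up to isometry, the set of `6` equiangular lines in `ℝ³`, i.e. the lines joining
opposite vertices of a regular icosahedron. -/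
def IsSixLinesInSpace {d : ℕ} (Ω : Set (Line d)) : Prop :=
  d = 3 ∧ ∃ f : EuclideanSpace ℝ (Fin 3) ≃ₗᵢ[ℝ] EuclideanSpace ℝ (Fin d),
    Ω = linesThrough (f '' icosahedronVertices)

/-- `ρ = 2i + 1` for an integer `i ≥ 1`, `d = ρ(ρ-1)`, `n = (ρ²-1)(ρ-1)`, and there is a
quasi-symmetric `2`-`(2i(2i+1)-1, (2i-1)(i+1), i(2i²+i-2); i²+i-1, i²-1)` design. All the
subtractions of natural numbers are exact since `i ≥ 1`. -/
def DesignCaseHalf (d n : ℕ) (ρ : ℝ) : Prop :=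
  ∃ i : ℕ, 1 ≤ i ∧ ρ = 2 * i + 1 ∧ (d : ℝ) = ρ * (ρ - 1) ∧ (n : ℝ) = (ρ ^ 2 - 1) * (ρ - 1) ∧
    ExistsQuasiSymmetric2Design (2 * i * (2 * i + 1) - 1) ((2 * i - 1) * (i + 1))
      (i * (2 * i ^ 2 + i - 2)) (i ^ 2 + i - 1) (i ^ 2 - 1)

/-- There is a quasi-symmetric `2`-`(d, k, lam; s₁, s₂)` design in which `k` is a root of
`4x² - 4dx + (ρ-1)²(d+ρ)`, `lam = k(k-1)/(ρ²-d)`, `s₁ = k - (ρ-1)²/4` and `s₂ = k - (ρ²-1)/4`. -/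
def DesignCaseRoot (d : ℕ) (ρ : ℝ) : Prop :=
  ∃ k lam s₁ s₂ : ℕ,
    4 * (k : ℝ) ^ 2 - 4 * d * k + (ρ - 1) ^ 2 * (d + ρ) = 0 ∧
    (lam : ℝ) = k * (k - 1) / (ρ ^ 2 - d) ∧
    (s₁ : ℝ) = k - (ρ - 1) ^ 2 / 4 ∧
    (s₂ : ℝ) = k - (ρ ^ 2 - 1) / 4 ∧
    ExistsQuasiSymmetric2Design d k lam s₁ s₂

end

/-!
Let `n` be the number of lines and `ρ = κ⁻¹`. Unit vectors spanning an incoherent set of lines can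
be signed so that their Gram matrix is `(1 - κ) I + κ J` (`exists_isSimplexFrame_of_isIncoherent`).
This matrix is invertible, so that such a set has at most `d` lines, and if it has `d` of them the
vectors `a i` form a basis. Inverting the Gram matrix gives the inner product of two vectors from
their inner products with the basis (`IsSimplexFrame.inner_eq`).

A further line of an equiangular set is spanned by a unit vector `v` with `⟪a i, v⟫ = ± κ`, hence
by the block `N` of the indices where the sign is negative. That `v` is a unit vector says
`(d - 2 |N|) ^ 2 = (ρ - 1 + d) (d - ρ (ρ - 1))`, which fixes `|N|` up to complements, that is, up to
replacing `v` by `-v`; that two such vectors have inner product `κ` or `-κ` says that `|N ∩ N'|` is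
`|N| - (ρ - 1) ^ 2 / 4` or `|N| - (ρ ^ 2 - 1) / 4`. Equality in the relative bound makes the `n`
unit vectors a tight frame (`sum_inner_mul_inner_of_relative_bound`), so that the signs of two
basis vectors have the same correlation for all pairs, and this makes the blocks a `2`-design. If
`d ≠ ρ (ρ - 1)`, the signs of the `v` are chosen so that the blocks have the same size other than
`d / 2`, which also fixes the number of blocks through a point
(`IsSaturatedExtension.designCaseRoot`). If `d = ρ (ρ - 1)`, all blocks have `d / 2` points; they
are made to share a point, and deleting it leaves a `2`-design
(`IsSaturatedExtension.designCaseHalf`).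

Both intersection numbers occur when `d ≥ 4`: from `ρ (ρ - 1) ≤ d < ρ ^ 2` one gets `ρ < d - 1` and
more than `d` blocks, whereas inner products all equal to `κ` allow at most `d` vectors and inner
products all equal to `-κ` at most `ρ + 1`. In dimensions `2` and `3` the equation for the block
size forces `ρ = 2` and `ρ = √5`, and the lines are those of the hexagon and the icosahedron.

Conversely, the blocks of a design prescribe the inner products of vectors with a basis of Gram
matrix `(1 - κ) I + κ J`, and the same formulas show that these are unit vectors with inner
products `± κ` (`exists_lines_of_blocks`); counting the blocks gives equality in the relative
bound.
-/

/-! ### Lines and unit vectors -/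

theorem Line.exists_smul_eq {d : ℕ} {l : Line d} {x y : EuclideanSpace ℝ (Fin d)} (hx : x ≠ 0)
    (hxl : x ∈ l.submodule) (hyl : y ∈ l.submodule) : ∃ c : ℝ, y = c • x := by
  rw [Projectivization.submodule_eq, Submodule.mem_span_singleton] at hxl hyl
  obtain ⟨a, rfl⟩ := hxl
  obtain ⟨b, rfl⟩ := hyl
  have ha : a ≠ 0 := fun h => hx (by simp [h])
  exact ⟨b / a, by rw [smul_smul, div_mul_cancel₀ _ ha]⟩

theorem Line.eq_of_mem {d : ℕ} {l m : Line d} {x : EuclideanSpace ℝ (Fin d)} (hx : x ≠ 0)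
    (hxl : x ∈ l.submodule) (hxm : x ∈ m.submodule) : l = m := by
  apply Projectivization.submodule_injective
  apply le_antisymm
  · intro y hy
    obtain ⟨c, rfl⟩ := Line.exists_smul_eq hx hxl hy
    exact Submodule.smul_mem _ _ hxm
  · intro y hy
    obtain ⟨c, rfl⟩ := Line.exists_smul_eq hx hxm hy
    exact Submodule.smul_mem _ _ hxl

theorem Line.exists_mem_submodule {d : ℕ} {x : EuclideanSpace ℝ (Fin d)} (hx : x ≠ 0) :
    ∃ l : Line d, x ∈ l.submodule :=
  ⟨Projectivization.mk ℝ x hx, by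
    rw [Projectivization.submodule_mk]; exact Submodule.mem_span_singleton_self x⟩

theorem IsUnitVectorOf.ne_zero {d : ℕ} {u : EuclideanSpace ℝ (Fin d)} {l : Line d}
    (h : IsUnitVectorOf u l) : u ≠ 0 := by
  intro h0
  have := h.2
  simp [h0] at this

theorem Line.exists_isUnitVectorOf {d : ℕ} (l : Line d) :
    ∃ u : EuclideanSpace ℝ (Fin d), IsUnitVectorOf u l := by
  refine ⟨(‖l.rep‖⁻¹ : ℝ) • l.rep, ?_, ?_⟩
  · rw [Projectivization.submodule_eq]
    exact Submodule.smul_mem _ _ (Submodule.mem_span_singleton_self _)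
  · rw [norm_smul, norm_inv, norm_norm]
    exact inv_mul_cancel₀ (norm_ne_zero_iff.mpr l.rep_nonzero)

theorem IsUnitVectorOf.eq_or_eq_neg {d : ℕ} {u v : EuclideanSpace ℝ (Fin d)} {l : Line d}
    (hu : IsUnitVectorOf u l) (hv : IsUnitVectorOf v l) : v = u ∨ v = -u := by
  obtain ⟨c, rfl⟩ := Line.exists_smul_eq hu.ne_zero hu.1 hv.1
  have h := hv.2
  rw [norm_smul, hu.2, mul_one, Real.norm_eq_abs] at h
  rcases (abs_eq zero_le_one).mp h with rfl | rfl
  · left; simp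
  · right; simp

/-- Equiangularity can be checked on one choice of unit vectors. -/
theorem isEquiangular_linesThrough_range {d : ℕ} {J : Type*} {w : J → EuclideanSpace ℝ (Fin d)}
    {κ : ℝ} (hw : ∀ j, ‖w j‖ = 1) (h : ∀ j k, j ≠ k → |inner ℝ (w j) (w k)| = κ) :
    IsEquiangular (linesThrough (Set.range w)) κ := by
  rintro l ⟨_, ⟨j, rfl⟩, -, hjl⟩ m ⟨_, ⟨k, rfl⟩, -, hkm⟩ hlm u v hu hv
  have hjk : j ≠ k := by
    rintro rfl
    exact hlm (Line.eq_of_mem (IsUnitVectorOf.ne_zero ⟨hjl, hw j⟩) hjl hkm)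
  rcases IsUnitVectorOf.eq_or_eq_neg ⟨hjl, hw j⟩ hu with rfl | rfl <;>
  rcases IsUnitVectorOf.eq_or_eq_neg ⟨hkm, hw k⟩ hv with rfl | rfl <;>
  simpa using h j k hjk

theorem isIncoherent_linesThrough_range {d : ℕ} {J : Type*} {w : J → EuclideanSpace ℝ (Fin d)}
    (h : ∀ j k, 0 < (inner ℝ (w j) (w k) : ℝ)) :
    IsIncoherent (linesThrough (Set.range w)) := by
  rintro l ⟨_, ⟨i, rfl⟩, hi, hil⟩ m ⟨_, ⟨j, rfl⟩, hj, hjm⟩ n ⟨_, ⟨k, rfl⟩, hk, hkn⟩ - - - u v x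
    hu hv hx
  obtain ⟨a, rfl⟩ := Line.exists_smul_eq hi hil hu.1
  obtain ⟨b, rfl⟩ := Line.exists_smul_eq hj hjm hv.1
  obtain ⟨c, rfl⟩ := Line.exists_smul_eq hk hkn hx.1
  have ha : a ≠ 0 := fun h => hu.ne_zero (by simp [h])
  have hb : b ≠ 0 := fun h => hv.ne_zero (by simp [h])
  have hc : c ≠ 0 := fun h => hx.ne_zero (by simp [h])
  simp only [real_inner_smul_left, real_inner_smul_right]
  have h1 := h i j
  have h2 := h i k
  have h3 := h j k
  have h4 : 0 < (a * b * c) ^ 2 := by positivity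
  have := mul_pos h4 (mul_pos (mul_pos h1 h2) h3)
  nlinarith [this]

/-- Vectors in a family no two of which are parallel span as many lines as there are indices. -/
theorem encard_linesThrough_range {d : ℕ} {J : Type*} {w : J → EuclideanSpace ℝ (Fin d)}
    (h0 : ∀ j, w j ≠ 0) (h : ∀ j k, (∃ c : ℝ, w k = c • w j) → j = k) :
    (linesThrough (Set.range w)).encard = ENat.card J := by
  choose L hL using fun j => Line.exists_mem_submodule (h0 j)
  have hinj : Function.Injective L := fun j k hjk =>
    h j k (Line.exists_smul_eq (h0 j) (hL j) (hjk ▸ hL k))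
  have : linesThrough (Set.range w) = Set.range L := by
    ext l
    constructor
    · rintro ⟨_, ⟨j, rfl⟩, hj, hjl⟩
      exact ⟨j, Line.eq_of_mem hj (hL j) hjl⟩
    · rintro ⟨j, rfl⟩
      exact ⟨_, ⟨j, rfl⟩, h0 j, hL j⟩
  rw [this, ← Set.image_univ, hinj.encard_image, Set.encard_univ]

/-- Unit vectors with inner products of absolute value less than `1` span distinct lines. -/
theorem encard_linesThrough_range_of_abs_inner_lt {d : ℕ} {J : Type*}
    {w : J → EuclideanSpace ℝ (Fin d)} (hw : ∀ j, ‖w j‖ = 1)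
    (h : ∀ j k, j ≠ k → |(inner ℝ (w j) (w k) : ℝ)| < 1) :
    (linesThrough (Set.range w)).encard = ENat.card J := by
  refine encard_linesThrough_range (fun j h0 => ?_) fun j k ⟨c, hc⟩ => ?_
  · have := hw j
    simp [h0] at this
  · by_contra hjk
    have h1 := h j k hjk
    have h2 := hw k
    rw [hc, norm_smul, hw j, mul_one, Real.norm_eq_abs] at h2
    rw [hc, real_inner_smul_right, real_inner_self_eq_norm_sq, hw j] at h1
    rw [one_pow, mul_one, h2] at h1
    exact lt_irrefl _ h1

/-! ### Unit vectors with constant inner product -/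

/-- The vectors `a i` are unit vectors, any two of them having inner product `κ`. -/
structure IsSimplexFrame {ι E : Type*} [NormedAddCommGroup E] [InnerProductSpace ℝ E]
    (a : ι → E) (κ : ℝ) : Prop where
  norm_eq_one : ∀ i, ‖a i‖ = 1
  inner_of_ne : ∀ i j, i ≠ j → inner ℝ (a i) (a j) = κ

section SimplexFrame

variable {ι E : Type*} [NormedAddCommGroup E] [InnerProductSpace ℝ E]
  {a : ι → E} {κ : ℝ}

theorem IsSimplexFrame.inner_eq_ite [DecidableEq ι] (h : IsSimplexFrame a κ) (i j : ι) :
    inner ℝ (a i) (a j) = if i = j then 1 else κ := by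
  split_ifs with hij
  · rw [hij, real_inner_self_eq_norm_sq, h.norm_eq_one, one_pow]
  · exact h.inner_of_ne i j hij

theorem IsSimplexFrame.inner_sum [Fintype ι] (h : IsSimplexFrame a κ) (c : ι → ℝ) (i : ι) :
    inner ℝ (a i) (∑ j, c j • a j) = (1 - κ) * c i + κ * ∑ j, c j := by
  classical
  simp only [_root_.inner_sum, real_inner_smul_right, h.inner_eq_ite i]
  have : ∀ j, c j * (if i = j then 1 else κ) = (if i = j then (1 - κ) * c j else 0) + κ * c j := by
    intro j
    split_ifs <;> ring
  simp only [this, Finset.sum_add_distrib, Finset.sum_ite_eq, Finset.mem_univ, if_true,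
    ← Finset.mul_sum]

theorem IsSimplexFrame.linearIndependent (h : IsSimplexFrame a κ) (h0 : 0 ≤ κ) (h1 : κ < 1) :
    LinearIndependent ℝ a := by
  classical
  rw [linearIndependent_iff_finset_linearIndependent]
  intro s
  have hs : IsSimplexFrame (a ∘ Subtype.val : s → E) κ :=
    ⟨fun i => h.norm_eq_one i, fun i j hij => h.inner_of_ne i j fun h => hij (Subtype.ext h)⟩
  rw [Fintype.linearIndependent_iff]
  intro c hc
  -- each coefficient is a multiple of the sum of all of them, which must therefore vanish
  have key : ∀ i, (1 - κ) * c i + κ * ∑ j, c j = 0 := fun i => by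
    rw [← hs.inner_sum c i, hc, inner_zero_right]
  have hsum : (1 - κ) * ∑ i, c i + Fintype.card s * (κ * ∑ j, c j) = 0 := by
    have := Finset.sum_congr rfl fun (i : s) (_ : i ∈ Finset.univ) => key i
    rw [Finset.sum_add_distrib, ← Finset.mul_sum] at this
    simpa using this
  have hz : ∑ j, c j = 0 := by
    have h2 : ((1 - κ) + Fintype.card s * κ) * ∑ j, c j = 0 := by linarith
    have h3 : 0 < (1 - κ) + Fintype.card s * κ := by
      have : 0 ≤ (Fintype.card s : ℝ) * κ := by positivity
      linarith
    exact (mul_eq_zero.mp h2).resolve_left h3.ne'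
  intro i
  have := key i
  rw [hz, mul_zero, add_zero] at this
  exact (mul_eq_zero.mp this).resolve_left (by linarith)

theorem IsSimplexFrame.card_le_finrank [Fintype ι] [FiniteDimensional ℝ E]
    (h : IsSimplexFrame a κ) (h0 : 0 ≤ κ) (h1 : κ < 1) :
    Fintype.card ι ≤ Module.finrank ℝ E :=
  (h.linearIndependent h0 h1).fintype_card_le_finrank

/-- The vector of the span of a simplex frame with prescribed inner products `f i` with the members
of the frame; it comes from inverting the Gram matrix `(1 - κ) I + κ J`. -/
noncomputable def simplexDual [Fintype ι] (a : ι → E) (κ : ℝ) (f : ι → ℝ) : E :=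
  ∑ i, ((1 - κ)⁻¹ * (f i - κ * (∑ j, f j) / (1 - κ + κ * Fintype.card ι))) • a i

theorem IsSimplexFrame.inner_simplexDual [Fintype ι] (h : IsSimplexFrame a κ) (h0 : 0 ≤ κ)
    (h1 : κ < 1) (f : ι → ℝ) (i : ι) : inner ℝ (a i) (simplexDual a κ f) = f i := by
  have h2 : (1 - κ) ≠ 0 := by linarith
  have h3 : 0 < (1 - κ) + κ * Fintype.card ι := by
    have : 0 ≤ κ * Fintype.card ι := by positivity
    linarith
  have h3' := h3.ne'
  rw [simplexDual, h.inner_sum, ← Finset.mul_sum, Finset.sum_sub_distrib]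
  simp only [Finset.sum_const, Finset.card_univ, nsmul_eq_mul]
  field_simp
  ring

theorem eq_of_inner_frame_eq [Fintype ι] [FiniteDimensional ℝ E] (ha : LinearIndependent ℝ a)
    (hcard : Fintype.card ι = Module.finrank ℝ E) {x y : E}
    (hxy : ∀ i, inner ℝ (a i) x = (inner ℝ (a i) y : ℝ)) : x = y := by
  have hspan := ha.span_eq_top_of_card_eq_finrank' hcard
  refine ext_inner_left ℝ fun z => ?_
  have hz : z ∈ Submodule.span ℝ (Set.range a) := hspan ▸ Submodule.mem_top
  induction hz using Submodule.span_induction with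
  | mem z hz => obtain ⟨i, rfl⟩ := hz; exact hxy i
  | zero => simp
  | add u v _ _ hu hv => rw [inner_add_left, inner_add_left, hu, hv]
  | smul c u _ hu => rw [real_inner_smul_left, real_inner_smul_left, hu]

/-- Inner products in terms of the inner products with a simplex frame that is a basis. -/
theorem IsSimplexFrame.inner_eq [Fintype ι] [FiniteDimensional ℝ E] (h : IsSimplexFrame a κ)
    (h0 : 0 ≤ κ) (h1 : κ < 1) (hcard : Fintype.card ι = Module.finrank ℝ E) {x y : E}
    {f g : ι → ℝ} (hf : ∀ i, inner ℝ (a i) x = f i) (hg : ∀ i, inner ℝ (a i) y = g i) :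
    (1 - κ) * (1 - κ + κ * Fintype.card ι) * inner ℝ x y =
      (1 - κ + κ * Fintype.card ι) * ∑ i, f i * g i - κ * (∑ i, f i) * ∑ i, g i := by
  have hx : x = simplexDual a κ f :=
    eq_of_inner_frame_eq (h.linearIndependent h0 h1) hcard fun i => by
      rw [hf, h.inner_simplexDual h0 h1]
  have h2 : (1 - κ) ≠ 0 := by linarith
  have h3 : 0 < (1 - κ) + κ * Fintype.card ι := by
    have : 0 ≤ κ * Fintype.card ι := by positivity
    linarith
  have h3' := h3.ne'
  have : inner ℝ x y =
      (1 - κ)⁻¹ * (∑ i, f i * g i -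
        κ * (∑ j, f j) / (1 - κ + κ * Fintype.card ι) * ∑ i, g i) := by
    conv_lhs => rw [hx, simplexDual]
    simp only [sum_inner, real_inner_smul_left, hg]
    generalize κ * (∑ j, f j) / (1 - κ + κ * Fintype.card ι) = t
    rw [Finset.mul_sum (a := t), ← Finset.sum_sub_distrib, Finset.mul_sum]
    exact Finset.sum_congr rfl fun i _ => by ring
  rw [this]
  field_simp

/-- Two families with the same inner products, the first one a basis, differ by an isometry. -/
theorem exists_linearIsometryEquiv_of_inner_eq {F : Type*} [NormedAddCommGroup F]
    [InnerProductSpace ℝ F] [FiniteDimensional ℝ E] [FiniteDimensional ℝ F] [Fintype ι]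
    [Nonempty ι] (ha : LinearIndependent ℝ a) (hE : Fintype.card ι = Module.finrank ℝ E)
    (hF : Module.finrank ℝ E = Module.finrank ℝ F) {b : ι → F}
    (hab : ∀ i j, inner ℝ (b i) (b j) = (inner ℝ (a i) (a j) : ℝ)) :
    ∃ f : E ≃ₗᵢ[ℝ] F, ∀ i, f (a i) = b i := by
  let B := basisOfLinearIndependentOfCardEqFinrank ha hE
  have hB : ∀ i, B i = a i := fun i => by simp [B]
  let L : E →ₗ[ℝ] F := B.constr ℝ b
  have hL : ∀ i, L (a i) = b i := fun i => by rw [← hB i]; exact B.constr_basis ℝ b i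
  have hinner : ∀ x y : E, inner ℝ (L x) (L y) = (inner ℝ x y : ℝ) := by
    intro x y
    rw [← B.sum_repr x, ← B.sum_repr y]
    simp only [map_sum, map_smul, sum_inner, inner_sum, real_inner_smul_left,
      real_inner_smul_right, hB, hL, hab]
  exact ⟨(L.isometryOfInner hinner).toLinearIsometryEquiv hF, fun i => hL i⟩

end SimplexFrame

/-- For `0 ≤ κ < 1` a simplex frame of `d` vectors exists: the vectors
`p • e i + q • ∑ j, e j` form one when `p ^ 2 = 1 - κ` and `2 * p * q + d * q ^ 2 = κ`. -/
theorem exists_isSimplexFrame (d : ℕ) (hd : 1 ≤ d) {κ : ℝ} (h0 : 0 ≤ κ) (h1 : κ < 1) :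
    ∃ a : Fin d → EuclideanSpace ℝ (Fin d), IsSimplexFrame a κ := by
  have hd' : (0 : ℝ) < d := by exact_mod_cast hd
  set p := Real.sqrt (1 - κ)
  have hp : p ^ 2 = 1 - κ := Real.sq_sqrt (by linarith)
  set r := Real.sqrt (1 - κ + d * κ)
  have hr : r ^ 2 = 1 - κ + d * κ := Real.sq_sqrt (by nlinarith)
  set q := (r - p) / d with hq
  have hpq : 2 * p * q + d * q ^ 2 = κ := by
    rw [hq]
    field_simp
    linear_combination hr - hp
  have hinner : ∀ i j : Fin d,
      inner ℝ (WithLp.toLp 2 fun k => (if k = i then p else 0) + q : EuclideanSpace ℝ (Fin d))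
        (WithLp.toLp 2 fun k => (if k = j then p else 0) + q) =
      (if i = j then p ^ 2 else 0) + 2 * p * q + d * q ^ 2 := by
    intro i j
    simp only [PiLp.inner_apply, RCLike.inner_apply, conj_trivial]
    have : ∀ k : Fin d, ((if k = j then p else 0) + q) * ((if k = i then p else 0) + q) =
        (if k = i then (if i = j then p ^ 2 else 0) + p * q else 0) + (if k = j then p * q else 0)
          + q ^ 2 := by
      intro k
      by_cases hi : k = i
      · subst hi
        by_cases hj : k = j
        · simp [hj]; ring
        · simp [hj]; ring
      · by_cases hj : k = j
        · simp [hi, if_pos hj]; ring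
        · simp [hi, hj]; ring
    simp only [this, Finset.sum_add_distrib, Finset.sum_ite_eq', Finset.mem_univ, if_true,
      Finset.sum_const, Finset.card_univ, Fintype.card_fin, nsmul_eq_mul]
    ring
  refine ⟨fun i => WithLp.toLp 2 fun k => (if k = i then p else 0) + q, fun i => ?_,
    fun i j hij => ?_⟩
  · have h := hinner i i
    rw [real_inner_self_eq_norm_sq, if_pos rfl] at h
    exact (pow_eq_one_iff_of_nonneg (norm_nonneg _) two_ne_zero).mp (by linarith)
  · have h := hinner i j
    rw [if_neg hij] at h
    linarith

/-- The unit vectors of an incoherent set of equiangular lines can be signed so that all the inner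
products are positive. -/
theorem exists_isSimplexFrame_of_isIncoherent {d : ℕ} {Γ : Set (Line d)} {κ : ℝ} (hκ : 0 < κ)
    (he : IsEquiangular Γ κ) (hΓ : IsIncoherent Γ) :
    ∃ a : Γ → EuclideanSpace ℝ (Fin d), (∀ l, IsUnitVectorOf (a l) l) ∧ IsSimplexFrame a κ := by
  choose u hu using fun l : Line d => l.exists_isUnitVectorOf
  rcases Γ.eq_empty_or_nonempty with rfl | ⟨o, ho⟩
  · exact ⟨fun l => u l, fun l => hu l, fun l => l.2.elim, fun l => l.2.elim⟩
  -- every vector is signed by its inner product with the one on the line `o`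
  let a : Line d → EuclideanSpace ℝ (Fin d) := fun l =>
    if 0 ≤ (inner ℝ (u o) (u l) : ℝ) then u l else -u l
  have ha : ∀ l, IsUnitVectorOf (a l) l := by
    intro l
    simp only [a]
    split_ifs
    · exact hu l
    · exact ⟨neg_mem (hu l).1, by rw [norm_neg]; exact (hu l).2⟩
  have hao : a o = u o := if_pos (by rw [real_inner_self_eq_norm_sq]; positivity)
  have hpos : ∀ l ∈ Γ, l ≠ o → 0 < (inner ℝ (a o) (a l) : ℝ) := by
    intro l hl hlo
    have h1 := he o ho l hl hlo.symm _ _ (ha o) (ha l)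
    have h2 : 0 ≤ (inner ℝ (a o) (a l) : ℝ) := by
      rw [hao]
      simp only [a]
      split_ifs with h
      · exact h
      · rw [inner_neg_right]; linarith
    rw [abs_of_nonneg h2] at h1
    rwa [h1]
  have hpos' : ∀ l ∈ Γ, ∀ m ∈ Γ, l ≠ m → 0 < (inner ℝ (a l) (a m) : ℝ) := by
    intro l hl m hm hlm
    by_cases hlo : l = o
    · subst hlo
      exact hpos m hm hlm.symm
    by_cases hmo : m = o
    · subst hmo
      rw [real_inner_comm]
      exact hpos l hl hlm
    have h3 := hΓ o ho l hl m hm (Ne.symm hlo) (Ne.symm hmo) hlm _ _ _ (ha o) (ha l) (ha m)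
    exact (mul_pos_iff_of_pos_left (mul_pos (hpos l hl hlo) (hpos m hm hmo))).mp h3
  refine ⟨fun l => a l, fun l => ha l, fun l => (ha l).2, fun l m hlm => ?_⟩
  have hlm' : (l : Line d) ≠ m := fun h => hlm (Subtype.ext h)
  have h4 := he l l.2 m m.2 hlm' _ _ (ha l) (ha m)
  rwa [abs_of_pos (hpos' l l.2 m m.2 hlm')] at h4

theorem IsEquiangular.mono {d : ℕ} {Γ Ω : Set (Line d)} {κ : ℝ} (h : IsEquiangular Ω κ)
    (hΓ : Γ ⊆ Ω) : IsEquiangular Γ κ :=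
  fun l hl m hm => h l (hΓ hl) m (hΓ hm)

theorem IsIncoherent.mono {d : ℕ} {Γ Δ : Set (Line d)} (h : IsIncoherent Δ) (hΓ : Γ ⊆ Δ) :
    IsIncoherent Γ :=
  fun l hl m hm n hn => h l (hΓ hl) m (hΓ hm) n (hΓ hn)

theorem Inc_le {d : ℕ} {Ω : Set (Line d)} {κ : ℝ} (hκ : 0 < κ) (h1 : κ < 1)
    (he : IsEquiangular Ω κ) (hfin : Ω.Finite) : Inc Ω ≤ d := by
  refine iSup₂_le fun Γ hΓ => ?_
  obtain ⟨a, -, ha⟩ := exists_isSimplexFrame_of_isIncoherent hκ (he.mono hΓ.1) hΓ.2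
  have := (hfin.subset hΓ.1).fintype
  have h := ha.card_le_finrank hκ.le h1
  rw [finrank_euclideanSpace_fin] at h
  rw [Set.encard_eq_coe_toFinset_card, Set.toFinset_card]
  exact_mod_cast h

theorem Inc_eq_of_le_encard {d : ℕ} {Ω Γ : Set (Line d)} {κ : ℝ} (hκ : 0 < κ) (h1 : κ < 1)
    (he : IsEquiangular Ω κ) (hfin : Ω.Finite) (hΓ : Γ ⊆ Ω) (hinc : IsIncoherent Γ)
    (hcard : d ≤ Γ.encard) : Inc Ω = d :=
  le_antisymm (Inc_le hκ h1 he hfin)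
    (hcard.trans (le_iSup₂ (f := fun (Γ : Set (Line d)) (_ : Γ ⊆ Ω ∧ IsIncoherent Γ) => Γ.encard)
      Γ ⟨hΓ, hinc⟩))

theorem exists_isIncoherent_of_Inc_eq {d : ℕ} (hd : 1 ≤ d) {Ω : Set (Line d)} (h : Inc Ω = d) :
    ∃ Γ ⊆ Ω, IsIncoherent Γ ∧ Γ.encard = d := by
  have hlt : ((d - 1 : ℕ) : ℕ∞) < Inc Ω := by
    rw [h]
    exact_mod_cast Nat.sub_lt hd one_pos
  rw [Inc] at hlt
  obtain ⟨Γ, hlt⟩ := lt_iSup_iff.mp hlt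
  obtain ⟨hΓ, hlt⟩ := lt_iSup_iff.mp hlt
  have hle : (d : ℕ∞) ≤ Γ.encard := by
    have := Order.add_one_le_of_lt hlt
    have h2 : ((d - 1 : ℕ) : ℕ∞) + 1 = d := by exact_mod_cast Nat.sub_add_cancel hd
    rwa [h2] at this
  obtain ⟨Δ, hΔ, hcard⟩ := Set.exists_subset_encard_eq hle
  exact ⟨Δ, hΔ.trans hΓ.1, hΓ.2.mono hΔ, hcard⟩

/-! ### Saturation of the relative bound -/

/-- Equality in the relative bound makes the unit vectors a tight frame: with `F` the matrix of
the frame operator and `n` the number of vectors, equality says that `d • F - n • 1` has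
Frobenius norm zero. -/
theorem sum_inner_mul_inner_of_relative_bound {d : ℕ} {J : Type*} [Fintype J]
    {w : J → EuclideanSpace ℝ (Fin d)} {κ : ℝ} (hw : ∀ j, ‖w j‖ = 1)
    (h : ∀ j k, j ≠ k → |(inner ℝ (w j) (w k) : ℝ)| = κ)
    (hn : Fintype.card J * (1 - κ ^ 2 * d) = d * (1 - κ ^ 2)) (x y : EuclideanSpace ℝ (Fin d)) :
    d * ∑ j, inner ℝ (w j) x * inner ℝ (w j) y = Fintype.card J * (inner ℝ x y : ℝ) := by
  classical
  set n : ℝ := (Fintype.card J : ℝ) with hndef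
  have hinner : ∀ x y : EuclideanSpace ℝ (Fin d), inner ℝ x y = ∑ p, x p * y p := fun x y => by
    simp only [PiLp.inner_apply, RCLike.inner_apply, conj_trivial, mul_comm]
  set F : Fin d → Fin d → ℝ := fun p q => ∑ j, w j p * w j q with hF
  have htr : ∑ p, F p p = n := by
    simp only [hF]
    rw [Finset.sum_comm]
    simp only [← hinner, real_inner_self_eq_norm_sq, hw, one_pow, Finset.sum_const,
      Finset.card_univ, nsmul_eq_mul, mul_one, hndef]
  have hsq : ∑ p, ∑ q, F p q ^ 2 = ∑ j, ∑ k, inner ℝ (w j) (w k) ^ 2 := by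
    simp only [hF, hinner, sq, Finset.sum_mul_sum]
    calc _ = ∑ p, ∑ j, ∑ k, ∑ q, w j p * w j q * (w k p * w k q) := by
          refine Finset.sum_congr rfl fun p _ => ?_
          rw [Finset.sum_comm]
          exact Finset.sum_congr rfl fun j _ => Finset.sum_comm
      _ = ∑ j, ∑ k, ∑ p, ∑ q, w j p * w j q * (w k p * w k q) := by
          rw [Finset.sum_comm]
          exact Finset.sum_congr rfl fun j _ => Finset.sum_comm
      _ = _ := by
          refine Finset.sum_congr rfl fun j _ => Finset.sum_congr rfl fun k _ =>
            Finset.sum_congr rfl fun p _ => Finset.sum_congr rfl fun q _ => ?_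
          ring
  have hsq' : ∑ j, ∑ k, (inner ℝ (w j) (w k) : ℝ) ^ 2 = n * (1 + (n - 1) * κ ^ 2) := by
    have : ∀ j k, (inner ℝ (w j) (w k) : ℝ) ^ 2 = (if j = k then 1 - κ ^ 2 else 0) + κ ^ 2 := by
      intro j k
      split_ifs with hjk
      · rw [hjk, real_inner_self_eq_norm_sq, hw]; ring
      · rw [← sq_abs, h j k hjk]; ring
    simp only [this, Finset.sum_add_distrib, Finset.sum_ite_eq, Finset.mem_univ, if_true,
      Finset.sum_const, Finset.card_univ, nsmul_eq_mul, ← hndef]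
    ring
  have hzero : ∑ p, ∑ q, (d * F p q - if p = q then n else 0) ^ 2 = 0 := by
    have : ∀ p q, (d * F p q - if p = q then n else 0) ^ 2 =
        d ^ 2 * F p q ^ 2 - (if p = q then 2 * d * n * F p p - n ^ 2 else 0) := by
      intro p q
      split_ifs with hpq
      · rw [← hpq]; ring
      · ring
    simp only [this, Finset.sum_sub_distrib, ← Finset.mul_sum, Finset.sum_ite_eq,
      Finset.mem_univ, if_true, Finset.sum_const, Finset.card_univ, Fintype.card_fin,
      nsmul_eq_mul, htr, hsq, hsq']
    linear_combination (-d * n) * hn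
  have hFpq : ∀ p q, d * F p q = if p = q then n else 0 := by
    intro p q
    have h1 := (Finset.sum_eq_zero_iff_of_nonneg fun p _ =>
      Finset.sum_nonneg fun q _ => sq_nonneg _).mp hzero p (Finset.mem_univ p)
    have h2 := (Finset.sum_eq_zero_iff_of_nonneg fun q _ => sq_nonneg _).mp h1 q
      (Finset.mem_univ q)
    exact sub_eq_zero.mp (pow_eq_zero_iff two_ne_zero |>.mp h2)
  calc d * ∑ j, inner ℝ (w j) x * inner ℝ (w j) y
      = ∑ p, ∑ q, (d * F p q) * (x p * y q) := by
        simp only [hinner, Finset.sum_mul_sum, hF]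
        simp only [Finset.mul_sum, Finset.sum_mul]
        rw [Finset.sum_comm]
        refine Finset.sum_congr rfl fun p _ => ?_
        rw [Finset.sum_comm]
        refine Finset.sum_congr rfl fun q _ => Finset.sum_congr rfl fun j _ => ?_
        ring
    _ = n * inner ℝ x y := by
        simp only [hFpq, hinner, ite_mul, zero_mul, Finset.sum_ite_eq, Finset.mem_univ, if_true,
          ← Finset.mul_sum]

/-! ### Signs of blocks and `2`-designs -/

/-- The `±1`-vector of a set of points, equal to `-1` on the set. -/
def blockSign {P : Type*} [DecidableEq P] (N : Finset P) (i : P) : ℝ := if i ∈ N then -1 else 1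

section Designs

variable {P : Type*} [DecidableEq P]

theorem blockSign_mul_self (N : Finset P) (i : P) : blockSign N i * blockSign N i = 1 := by
  unfold blockSign
  split_ifs <;> norm_num

theorem abs_blockSign (N : Finset P) (i : P) : |blockSign N i| = 1 := by
  unfold blockSign
  split_ifs <;> norm_num

variable [Fintype P]

theorem sum_blockSign (N : Finset P) :
    ∑ i, blockSign N i = Fintype.card P - 2 * (N.card : ℝ) := by
  have : ∀ i, blockSign N i = 1 - 2 * (if i ∈ N then 1 else 0) := fun i => by
    unfold blockSign; split_ifs <;> norm_num
  simp only [this, Finset.sum_sub_distrib, ← Finset.mul_sum, Finset.sum_boole,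
    Finset.filter_univ_mem, Finset.sum_const, Finset.card_univ, nsmul_eq_mul, mul_one]

theorem sum_blockSign_mul (N M : Finset P) :
    ∑ i, blockSign N i * blockSign M i =
      Fintype.card P - 2 * (N.card : ℝ) - 2 * (M.card : ℝ) + 4 * ((N ∩ M).card : ℝ) := by
  have : ∀ i, blockSign N i * blockSign M i = 1 - 2 * (if i ∈ N then 1 else 0) -
      2 * (if i ∈ M then 1 else 0) + 4 * (if i ∈ N ∩ M then 1 else 0) := fun i => by
    unfold blockSign
    simp only [Finset.mem_inter]
    by_cases h1 : i ∈ N <;> by_cases h2 : i ∈ M <;> simp [h1, h2] <;> norm_num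
  simp only [this, Finset.sum_sub_distrib, Finset.sum_add_distrib, ← Finset.mul_sum,
    Finset.sum_boole, Finset.filter_univ_mem, Finset.sum_const, Finset.card_univ, nsmul_eq_mul,
    mul_one]

/-- The number of blocks of a `2`-design: count the pairs of points inside a block. -/
theorem IsDesign.card_mul {v k lam : ℕ} {B : Finset (Finset P)} (h : IsDesign 2 v k lam B) :
    (B.card : ℝ) * (k * (k - 1)) = lam * (v * (v - 1)) := by
  have key := Finset.sum_card_bipartiteAbove_eq_sum_card_bipartiteBelow
    (fun (T b : Finset P) => T ⊆ b) (s := Finset.univ.powersetCard 2) (t := B)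
  have h1 : ∀ T ∈ (Finset.univ : Finset P).powersetCard 2,
      (Finset.bipartiteAbove (fun (T b : Finset P) => T ⊆ b) B T).card = lam := fun T hT =>
    h.card_blocks_through T (Finset.mem_powersetCard.mp hT).2
  have h2 : ∀ b ∈ B, (Finset.bipartiteBelow (fun (T b : Finset P) => T ⊆ b)
      ((Finset.univ : Finset P).powersetCard 2) b).card = k.choose 2 := fun b hb => by
    rw [← h.card_block b hb, ← Finset.card_powersetCard]
    congr 1
    ext T
    simp [Finset.bipartiteBelow, Finset.mem_powersetCard, and_comm]
  rw [Finset.sum_congr rfl h1, Finset.sum_congr rfl h2, Finset.sum_const, Finset.sum_const,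
    Finset.card_powersetCard, Finset.card_univ, h.card_points] at key
  have key' : ((v.choose 2 : ℕ) : ℝ) * lam = B.card * (k.choose 2 : ℕ) := by
    exact_mod_cast key
  rw [Nat.cast_choose_two, Nat.cast_choose_two] at key'
  linarith

/-- Blocks form a `2`-design when their sign vectors, read as a matrix, have constant row sums and
constant inner products of distinct rows. -/
theorem exists_isDesign_of_sum_blockSign {β : Type*} [Fintype β] {N : β → Finset P}
    (hN : Function.Injective N) {k : ℕ} (hk : ∀ b, (N b).card = k) {r m : ℝ}
    (hr : ∀ i, ∑ b, blockSign (N b) i = r)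
    (hm : ∀ i j, i ≠ j → ∑ b, blockSign (N b) i * blockSign (N b) j = m) :
    ∃ lam, IsDesign 2 (Fintype.card P) k lam (Finset.univ.image N) := by
  have hcount : ∀ T : Finset P, T.card = 2 →
      (((Finset.univ.image N).filter fun b => T ⊆ b).card : ℝ) =
        (Fintype.card β - 2 * r + m) / 4 := by
    intro T hT
    obtain ⟨i, j, hij, rfl⟩ := Finset.card_eq_two.mp hT
    rw [Finset.filter_image, Finset.card_image_of_injective _ hN, ← Finset.sum_boole]
    have : ∀ b, (if {i, j} ⊆ N b then (1 : ℝ) else 0) = 4⁻¹ * (1 - blockSign (N b) i -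
        blockSign (N b) j + blockSign (N b) i * blockSign (N b) j) := fun b => by
      unfold blockSign
      simp only [Finset.insert_subset_iff, Finset.singleton_subset_iff]
      by_cases h1 : i ∈ N b <;> by_cases h2 : j ∈ N b <;> norm_num [h1, h2]
    simp only [this, ← Finset.mul_sum, Finset.sum_add_distrib, Finset.sum_sub_distrib, hr,
      hm i j hij, Finset.sum_const, Finset.card_univ, nsmul_eq_mul, mul_one]
    ring
  have hblock : ∀ b ∈ Finset.univ.image N, b.card = k := fun b hb => by
    obtain ⟨c, -, rfl⟩ := Finset.mem_image.mp hb
    exact hk c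
  by_cases hT : ∃ T : Finset P, T.card = 2
  · obtain ⟨T, hT⟩ := hT
    refine ⟨((Finset.univ.image N).filter fun b => T ⊆ b).card, rfl, hblock, fun S hS => ?_⟩
    have := (hcount S hS).trans (hcount T hT).symm
    exact_mod_cast this
  · exact ⟨0, rfl, hblock, fun T h => (hT ⟨T, h⟩).elim⟩

theorem isQuasiSymmetricDesign_image {β : Type*} [Fintype β] {N : β → Finset P}
    {v k lam s₁ s₂ : ℕ} (hN : IsDesign 2 v k lam (Finset.univ.image N)) (hs : s₁ ≠ s₂)
    (hinj : Function.Injective N)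
    (h : ∀ b c, b ≠ c → (N b ∩ N c).card = s₁ ∨ (N b ∩ N c).card = s₂)
    (h₁ : ∃ b c, b ≠ c ∧ (N b ∩ N c).card = s₁) (h₂ : ∃ b c, b ≠ c ∧ (N b ∩ N c).card = s₂) :
    IsQuasiSymmetricDesign 2 v k lam s₁ s₂ (Finset.univ.image N) where
  toIsDesign := hN
  ne := hs
  inter := by
    intro x hx y hy hxy
    obtain ⟨b, -, rfl⟩ := Finset.mem_image.mp hx
    obtain ⟨c, -, rfl⟩ := Finset.mem_image.mp hy
    exact h b c fun hbc => hxy (hbc ▸ rfl)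
  exists_inter_fst := by
    obtain ⟨b, c, hbc, hs⟩ := h₁
    exact ⟨N b, Finset.mem_image_of_mem _ (Finset.mem_univ b), N c,
      Finset.mem_image_of_mem _ (Finset.mem_univ c), hinj.ne hbc, hs⟩
  exists_inter_snd := by
    obtain ⟨b, c, hbc, hs⟩ := h₂
    exact ⟨N b, Finset.mem_image_of_mem _ (Finset.mem_univ b), N c,
      Finset.mem_image_of_mem _ (Finset.mem_univ c), hinj.ne hbc, hs⟩

end Designs

/-! ### Unit vectors extending a simplex frame -/

/-- Inner products of vectors given by sign patterns with respect to a simplex frame which is a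
basis, written in terms of `ρ = κ⁻¹`. -/
theorem IsSimplexFrame.inner_of_blockSign {d : ℕ} {a : Fin d → EuclideanSpace ℝ (Fin d)} {κ ρ : ℝ}
    (h : IsSimplexFrame a κ) (h0 : 0 < κ) (h1 : κ < 1) (hκρ : κ * ρ = 1)
    {x y : EuclideanSpace ℝ (Fin d)} {N M : Finset (Fin d)}
    (hx : ∀ i, inner ℝ (a i) x = κ * blockSign N i)
    (hy : ∀ i, inner ℝ (a i) y = κ * blockSign M i) :
    ρ * (ρ - 1) * (ρ - 1 + d) * inner ℝ x y =
      (ρ - 1 + d) * (d - 2 * (N.card : ℝ) - 2 * (M.card : ℝ) + 4 * ((N ∩ M).card : ℝ)) -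
        (d - 2 * (N.card : ℝ)) * (d - 2 * (M.card : ℝ)) := by
  have key := h.inner_eq h0.le h1 (by simp) hx hy
  have e1 : ∑ i, κ * blockSign N i * (κ * blockSign M i) =
      κ ^ 2 * ∑ i, blockSign N i * blockSign M i := by
    rw [Finset.mul_sum]
    exact Finset.sum_congr rfl fun i _ => by ring
  rw [e1, ← Finset.mul_sum, ← Finset.mul_sum, sum_blockSign_mul, sum_blockSign,
    sum_blockSign, Fintype.card_fin] at key
  have hκ : κ = ρ⁻¹ := eq_inv_of_mul_eq_one_left hκρ
  have hρ : ρ ≠ 0 := right_ne_zero_of_mul_eq_one hκρ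
  rw [hκ] at key
  field_simp at key
  linear_combination key

/-- A simplex frame `a` which is a basis, together with further unit vectors `v b` spanning, with
`a`, a set of equiangular lines that saturates the relative bound. -/
structure IsSaturatedExtension {d : ℕ} {β : Type*} [Fintype β]
    (a : Fin d → EuclideanSpace ℝ (Fin d)) (v : β → EuclideanSpace ℝ (Fin d)) (κ ρ : ℝ) :
    Prop where
  frame : IsSimplexFrame a κ
  two_le : 2 ≤ d
  pos : 0 < κ
  mul_eq_one : κ * ρ = 1
  lt_sq : d < ρ ^ 2
  norm_eq_one : ∀ b, ‖v b‖ = 1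
  abs_inner_frame : ∀ i b, |(inner ℝ (a i) (v b) : ℝ)| = κ
  abs_inner : ∀ b c, b ≠ c → |(inner ℝ (v b) (v c) : ℝ)| = κ
  card_mul : (Fintype.card β : ℝ) * (ρ ^ 2 - d) = d * (d - 1)

/-- The positions in which the inner product with a member of the frame is negative. -/
noncomputable def negSet {d : ℕ} (a : Fin d → EuclideanSpace ℝ (Fin d))
    (x : EuclideanSpace ℝ (Fin d)) : Finset (Fin d) :=
  Finset.univ.filter fun i => (inner ℝ (a i) x : ℝ) < 0

namespace IsSaturatedExtension

variable {d : ℕ} {β : Type*} [Fintype β] {a : Fin d → EuclideanSpace ℝ (Fin d)}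
  {v : β → EuclideanSpace ℝ (Fin d)} {κ ρ : ℝ}

theorem rho_pos (h : IsSaturatedExtension a v κ ρ) : 0 < ρ :=
  (mul_pos_iff_of_pos_left h.pos).mp (by rw [h.mul_eq_one]; exact one_pos)

theorem one_lt_rho (h : IsSaturatedExtension a v κ ρ) : 1 < ρ := by
  have h2 : (2 : ℝ) ≤ d := by exact_mod_cast h.two_le
  have := h.lt_sq
  have := h.rho_pos
  nlinarith

theorem lt_one (h : IsSaturatedExtension a v κ ρ) : κ < 1 := by
  have := h.one_lt_rho
  have := h.mul_eq_one
  have := h.pos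
  nlinarith

/-- The vectors `v b` only matter up to sign. -/
theorem smul (h : IsSaturatedExtension a v κ ρ) {σ : β → ℝ} (hσ : ∀ b, |σ b| = 1) :
    IsSaturatedExtension a (fun b => σ b • v b) κ ρ where
  frame := h.frame
  two_le := h.two_le
  pos := h.pos
  mul_eq_one := h.mul_eq_one
  lt_sq := h.lt_sq
  norm_eq_one b := by rw [norm_smul, Real.norm_eq_abs, hσ, h.norm_eq_one, one_mul]
  abs_inner_frame i b := by
    rw [real_inner_smul_right, abs_mul, hσ, one_mul, h.abs_inner_frame]
  abs_inner b c hbc := by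
    rw [real_inner_smul_right, real_inner_smul_left, abs_mul, abs_mul, hσ, hσ, one_mul, one_mul,
      h.abs_inner b c hbc]
  card_mul := h.card_mul

theorem inner_frame (h : IsSaturatedExtension a v κ ρ) (i : Fin d) (b : β) :
    inner ℝ (a i) (v b) = κ * blockSign (negSet a (v b)) i := by
  have h1 := h.abs_inner_frame i b
  simp only [blockSign, negSet, Finset.mem_filter, Finset.mem_univ, true_and]
  split_ifs with hneg
  · rw [abs_of_neg hneg] at h1; linarith
  · rw [abs_of_nonneg (not_lt.mp hneg)] at h1; linarith

theorem sq_sub_two_mul_card (h : IsSaturatedExtension a v κ ρ) (b : β) :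
    (d - 2 * ((negSet a (v b)).card : ℝ)) ^ 2 = (ρ - 1 + d) * (d - ρ * (ρ - 1)) := by
  have key := h.frame.inner_of_blockSign h.pos h.lt_one h.mul_eq_one
    (fun i => h.inner_frame i b) (fun i => h.inner_frame i b)
  rw [real_inner_self_eq_norm_sq, h.norm_eq_one, Finset.inter_self] at key
  linear_combination key

theorem root_eq (h : IsSaturatedExtension a v κ ρ) (b : β) :
    4 * ((negSet a (v b)).card : ℝ) ^ 2 - 4 * d * (negSet a (v b)).card +
      (ρ - 1) ^ 2 * (d + ρ) = 0 := by
  linear_combination h.sq_sub_two_mul_card b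

theorem card_sub_card_inter (h : IsSaturatedExtension a v κ ρ) {b c : β}
    (hbc : (negSet a (v b)).card = (negSet a (v c)).card) :
    4 * (((negSet a (v b)).card : ℝ) - (negSet a (v b) ∩ negSet a (v c)).card) =
      ρ * (ρ - 1) * (1 - inner ℝ (v b) (v c)) := by
  have key := h.frame.inner_of_blockSign h.pos h.lt_one h.mul_eq_one
    (fun i => h.inner_frame i b) (fun i => h.inner_frame i c)
  have hs := h.sq_sub_two_mul_card b
  rw [← hbc] at key
  have hpos : ρ - 1 + d ≠ 0 := by
    have := h.one_lt_rho
    have : (0 : ℝ) ≤ d := Nat.cast_nonneg d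
    linarith
  apply mul_left_cancel₀ hpos
  linear_combination key - hs

theorem inner_eq_or (h : IsSaturatedExtension a v κ ρ) {b c : β} (hbc : b ≠ c) :
    inner ℝ (v b) (v c) = κ ∨ inner ℝ (v b) (v c) = -κ :=
  (abs_eq h.pos.le).mp (h.abs_inner b c hbc)

theorem negSet_injective (h : IsSaturatedExtension a v κ ρ) :
    Function.Injective fun b => negSet a (v b) := by
  intro b c hbc
  by_contra hne
  have hv : v b = v c := eq_of_inner_frame_eq
    (h.frame.linearIndependent h.pos.le h.lt_one) (by simp) fun i => by
      rw [h.inner_frame, h.inner_frame]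
      simp only at hbc
      rw [hbc]
  have h1 := h.abs_inner b c hne
  rw [hv, real_inner_self_eq_norm_sq, h.norm_eq_one, one_pow, abs_one] at h1
  exact h.lt_one.ne' h1

theorem nonempty (h : IsSaturatedExtension a v κ ρ) : Nonempty β := by
  rw [← Fintype.card_pos_iff]
  by_contra hz
  have hz' : Fintype.card β = 0 := by omega
  have := h.card_mul
  rw [hz', Nat.cast_zero, zero_mul] at this
  have h2 : (2 : ℝ) ≤ d := by exact_mod_cast h.two_le
  nlinarith

theorem rho_mul_le (h : IsSaturatedExtension a v κ ρ) : ρ * (ρ - 1) ≤ d := by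
  obtain ⟨b⟩ := h.nonempty
  have h1 := h.sq_sub_two_mul_card b
  have h2 := h.one_lt_rho
  have h3 : (0 : ℝ) ≤ d := Nat.cast_nonneg d
  by_contra hlt
  have : (ρ - 1 + d) * (d - ρ * (ρ - 1)) < 0 :=
    mul_neg_of_pos_of_neg (by linarith) (by linarith)
  nlinarith [sq_nonneg (d - 2 * ((negSet a (v b)).card : ℝ))]

theorem rho_lt (h : IsSaturatedExtension a v κ ρ) (hd : 4 ≤ d) : ρ < d - 1 := by
  have h1 := h.rho_mul_le
  have hd' : (4 : ℝ) ≤ d := by exact_mod_cast hd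
  by_contra hle
  nlinarith

theorem lt_card (h : IsSaturatedExtension a v κ ρ) (hd : 4 ≤ d) : d < Fintype.card β := by
  have h1 := h.rho_mul_le
  have h2 := h.rho_lt hd
  have h3 := h.lt_sq
  have h4 := h.card_mul
  have hd' : (4 : ℝ) ≤ d := by exact_mod_cast hd
  have : (d : ℝ) < Fintype.card β := by
    by_contra hle
    nlinarith
  exact_mod_cast this

/-- If all the inner products were `κ`, the vectors would be linearly independent, but there are
more than `d` of them. -/
theorem exists_inner_eq_neg (h : IsSaturatedExtension a v κ ρ) (hd : 4 ≤ d) :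
    ∃ b c, b ≠ c ∧ inner ℝ (v b) (v c) = -κ := by
  by_contra! hcon
  have hv : IsSimplexFrame v κ :=
    ⟨h.norm_eq_one, fun b c hbc => (h.inner_eq_or hbc).resolve_right (hcon b c hbc)⟩
  have h1 := hv.card_le_finrank h.pos.le h.lt_one
  rw [finrank_euclideanSpace_fin] at h1
  exact absurd h1 (not_le.mpr (h.lt_card hd))

/-- If all the inner products were `-κ`, the sum of the vectors would have a negative square. -/
theorem exists_inner_eq_pos (h : IsSaturatedExtension a v κ ρ) (hd : 4 ≤ d) :
    ∃ b c, b ≠ c ∧ inner ℝ (v b) (v c) = κ := by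
  classical
  by_contra! hcon
  have hinner : ∀ b c, (inner ℝ (v b) (v c) : ℝ) = (if b = c then 1 + κ else 0) - κ := by
    intro b c
    split_ifs with hbc
    · rw [hbc, real_inner_self_eq_norm_sq, h.norm_eq_one]; ring
    · rw [(h.inner_eq_or hbc).resolve_left (hcon b c hbc)]; ring
  have hsum : (inner ℝ (∑ b, v b) (∑ c, v c) : ℝ) =
      Fintype.card β * (1 + κ - κ * Fintype.card β) := by
    simp only [sum_inner, inner_sum]
    rw [Finset.sum_comm]
    simp only [hinner, Finset.sum_sub_distrib, Finset.sum_ite_eq, Finset.mem_univ, if_true,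
      Finset.sum_const, Finset.card_univ, nsmul_eq_mul]
    ring
  rw [real_inner_self_eq_norm_sq] at hsum
  have h1 : (d : ℝ) < Fintype.card β := by exact_mod_cast h.lt_card hd
  have h2 := h.rho_lt hd
  have h3 : 1 + κ - κ * Fintype.card β < 0 := by
    have h4 : κ * (ρ + 1) < κ * Fintype.card β := mul_lt_mul_of_pos_left (by linarith) h.pos
    have := h.mul_eq_one
    linarith
  have h5 : (0 : ℝ) < Fintype.card β := lt_of_le_of_lt (Nat.cast_nonneg d) h1
  nlinarith [sq_nonneg ‖∑ b, v b‖]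

/-- Distinct rows of the matrix of signs have a constant inner product, as the frame is tight. -/
theorem exists_sum_blockSign_mul (h : IsSaturatedExtension a v κ ρ) :
    ∃ m, ∀ i j, i ≠ j →
      ∑ b, blockSign (negSet a (v b)) i * blockSign (negSet a (v b)) j = m := by
  have hd : (d : ℝ) ≠ 0 := by
    have := h.two_le
    exact_mod_cast (by omega : d ≠ 0)
  have htight := sum_inner_mul_inner_of_relative_bound (w := Sum.elim a v) (κ := κ)
    (fun j => by
      cases j with
      | inl i => exact h.frame.norm_eq_one i
      | inr b => exact h.norm_eq_one b)
    (fun j k hjk => by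
      cases j with
      | inl i =>
        cases k with
        | inl i' =>
          simp only [Sum.elim_inl]
          rw [h.frame.inner_of_ne i i' fun hi => hjk (hi ▸ rfl), abs_of_pos h.pos]
        | inr b => exact h.abs_inner_frame i b
      | inr b =>
        cases k with
        | inl i => simpa [real_inner_comm] using h.abs_inner_frame i b
        | inr b' => exact h.abs_inner b b' fun hb => hjk (hb ▸ rfl))
    (by
      have h1 := h.card_mul
      have hκ : κ = ρ⁻¹ := eq_inv_of_mul_eq_one_left h.mul_eq_one
      have hρ : ρ ≠ 0 := h.rho_pos.ne'
      rw [Fintype.card_sum, Fintype.card_fin, hκ]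
      push_cast
      field_simp
      linear_combination h1)
  refine ⟨((d : ℝ)⁻¹ * (Fintype.card (Fin d ⊕ β) * κ) - (2 * κ + (d - 2) * κ ^ 2)) / κ ^ 2,
    fun i j hij => ?_⟩
  have hκ := h.pos.ne'
  have h1 := htight (a i) (a j)
  rw [h.frame.inner_of_ne i j hij, Fintype.sum_sum_type] at h1
  simp only [Sum.elim_inl, Sum.elim_inr] at h1
  have e1 : ∀ k, (inner ℝ (a k) (a i) * inner ℝ (a k) (a j) : ℝ) =
      (if k = i then κ - κ ^ 2 else 0) + (if k = j then κ - κ ^ 2 else 0) + κ ^ 2 := by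
    intro k
    rw [h.frame.inner_eq_ite, h.frame.inner_eq_ite]
    by_cases hi : k = i
    · have hj : k ≠ j := fun hj => hij (hi ▸ hj)
      simp only [if_pos hi, if_neg hj]; ring
    · simp only [if_neg hi]
      split_ifs <;> ring
  have e2 : ∀ b, (inner ℝ (v b) (a i) * inner ℝ (v b) (a j) : ℝ) =
      κ ^ 2 * (blockSign (negSet a (v b)) i * blockSign (negSet a (v b)) j) := by
    intro b
    rw [real_inner_comm, h.inner_frame, real_inner_comm, h.inner_frame]
    ring
  simp only [e1, e2, Finset.sum_add_distrib, Finset.sum_ite_eq', Finset.mem_univ, if_true,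
    Finset.sum_const, Finset.card_univ, Fintype.card_fin, nsmul_eq_mul, ← Finset.mul_sum] at h1
  rw [eq_div_iff (pow_ne_zero 2 hκ)]
  have h2 : (d : ℝ)⁻¹ * (Fintype.card (Fin d ⊕ β) * κ) =
      κ - κ ^ 2 + (κ - κ ^ 2) + d * κ ^ 2 +
        κ ^ 2 * ∑ b, blockSign (negSet a (v b)) i * blockSign (negSet a (v b)) j := by
    rw [← h1, inv_mul_cancel_left₀ hd]
  rw [h2]
  ring

/-- If the blocks have a constant size other than `d / 2`, the matrix of signs has constant row
sums. -/
theorem exists_sum_blockSign (h : IsSaturatedExtension a v κ ρ) {k : ℕ}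
    (hk : ∀ b, (negSet a (v b)).card = k) (hkd : (d : ℝ) - 2 * k ≠ 0) :
    ∃ r, ∀ i, ∑ b, blockSign (negSet a (v b)) i = r := by
  obtain ⟨m, hm⟩ := h.exists_sum_blockSign_mul
  refine ⟨((Fintype.card β - m) + d * m) / (d - 2 * k), fun i => ?_⟩
  rw [eq_div_iff hkd]
  have h1 : ∀ b, blockSign (negSet a (v b)) i * ((d : ℝ) - 2 * k) =
      ∑ j, blockSign (negSet a (v b)) i * blockSign (negSet a (v b)) j := fun b => by
    rw [← Finset.mul_sum, sum_blockSign, hk, Fintype.card_fin]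
  rw [Finset.sum_mul, Finset.sum_congr rfl fun b _ => h1 b, Finset.sum_comm]
  have h2 : ∀ j, ∑ b, blockSign (negSet a (v b)) i * blockSign (negSet a (v b)) j =
      (if i = j then Fintype.card β - m else 0) + m := by
    intro j
    split_ifs with hij
    · subst hij
      simp only [blockSign_mul_self, Finset.sum_const, Finset.card_univ, nsmul_eq_mul]
      ring
    · rw [hm i j hij, zero_add]
  simp only [h2, Finset.sum_add_distrib, Finset.sum_ite_eq, Finset.mem_univ, if_true,
    Finset.sum_const, Finset.card_univ, Fintype.card_fin, nsmul_eq_mul]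

/-- The blocks have a constant size other than `d / 2`: they form a quasi-symmetric design on the
members of the frame. -/
theorem designCaseRoot (h : IsSaturatedExtension a v κ ρ) (hd : 4 ≤ d) {k : ℕ}
    (hk : ∀ b, (negSet a (v b)).card = k) (hkd : (d : ℝ) - 2 * k ≠ 0) : DesignCaseRoot d ρ := by
  obtain ⟨m, hm⟩ := h.exists_sum_blockSign_mul
  obtain ⟨r, hr⟩ := h.exists_sum_blockSign hk hkd
  obtain ⟨lam, hlam⟩ := exists_isDesign_of_sum_blockSign h.negSet_injective hk hr hm
  rw [Fintype.card_fin] at hlam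
  obtain ⟨b₁, c₁, hbc₁, hi₁⟩ := h.exists_inner_eq_pos hd
  obtain ⟨b₂, c₂, hbc₂, hi₂⟩ := h.exists_inner_eq_neg hd
  have hinter : ∀ b c, ((negSet a (v b) ∩ negSet a (v c)).card : ℝ) =
      k - ρ * (ρ - 1) * (1 - inner ℝ (v b) (v c)) / 4 := by
    intro b c
    have := h.card_sub_card_inter ((hk b).trans (hk c).symm)
    rw [hk] at this
    linarith
  have hpos : ∀ b c, inner ℝ (v b) (v c) = κ →
      ((negSet a (v b) ∩ negSet a (v c)).card : ℝ) = k - (ρ - 1) ^ 2 / 4 := by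
    intro b c hbc
    rw [hinter, hbc]
    linear_combination (ρ - 1) / 4 * h.mul_eq_one
  have hneg : ∀ b c, inner ℝ (v b) (v c) = -κ →
      ((negSet a (v b) ∩ negSet a (v c)).card : ℝ) = k - (ρ ^ 2 - 1) / 4 := by
    intro b c hbc
    rw [hinter, hbc]
    linear_combination -(ρ - 1) / 4 * h.mul_eq_one
  have hone := h.one_lt_rho
  refine ⟨k, lam, _, _, ?_, ?_, hpos b₁ c₁ hi₁, hneg b₂ c₂ hi₂, Finset.univ.image fun b =>
    negSet a (v b), isQuasiSymmetricDesign_image hlam ?_ h.negSet_injective ?_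
      ⟨b₁, c₁, hbc₁, rfl⟩ ⟨b₂, c₂, hbc₂, rfl⟩⟩
  · rw [← hk b₁]
    exact h.root_eq b₁
  · have h1 := hlam.card_mul
    rw [Finset.card_image_of_injective _ h.negSet_injective, Finset.card_univ] at h1
    have h2 := h.card_mul
    have h3 : ρ ^ 2 - d ≠ 0 := by linarith [h.lt_sq]
    have h4 : (d : ℝ) * (d - 1) ≠ 0 := by
      have hd' : (4 : ℝ) ≤ d := by exact_mod_cast hd
      exact mul_ne_zero (by linarith) (by linarith)
    rw [eq_div_iff h3]
    apply mul_left_cancel₀ h4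
    linear_combination (-(ρ ^ 2 - d)) * h1 + k * (k - 1) * h2
  · intro heq
    have h1 := hpos b₁ c₁ hi₁
    rw [heq, hneg b₂ c₂ hi₂] at h1
    nlinarith
  · intro b c hbc
    rcases h.inner_eq_or hbc with hi | hi
    · left
      exact_mod_cast (hpos b c hi).trans (hpos b₁ c₁ hi₁).symm
    · right
      exact_mod_cast (hneg b c hi).trans (hneg b₂ c₂ hi₂).symm

end IsSaturatedExtension

/-! ### The designs of a saturated extension -/

namespace IsSaturatedExtension

variable {d : ℕ} {β : Type*} [Fintype β] {a : Fin d → EuclideanSpace ℝ (Fin d)}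
  {v : β → EuclideanSpace ℝ (Fin d)} {κ ρ : ℝ}

/-- All the blocks have `d / 2` points: signing the vectors so that the blocks share a point, and
deleting that point, gives a quasi-symmetric design. -/
theorem designCaseHalf {m : ℕ} {a : Fin (m + 1) → EuclideanSpace ℝ (Fin (m + 1))}
    {v : β → EuclideanSpace ℝ (Fin (m + 1))} (h : IsSaturatedExtension a v κ ρ) (hd : 4 ≤ m + 1)
    (hhalf : ((m + 1 : ℕ) : ℝ) = ρ * (ρ - 1)) (hzero : ∀ b, 0 ∈ negSet a (v b)) :
    DesignCaseHalf (m + 1) (m + 1 + Fintype.card β) ρ := by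
  have hone := h.one_lt_rho
  -- the size of the blocks and their intersections
  have hk' : ∀ b, (2 * ((negSet a (v b)).card : ℝ)) = (m + 1 : ℕ) := by
    intro b
    have h1 := h.sq_sub_two_mul_card b
    rw [← hhalf, sub_self, mul_zero, sq_eq_zero_iff, sub_eq_zero] at h1
    exact h1.symm
  obtain ⟨k, hk⟩ : ∃ k, ∀ b, (negSet a (v b)).card = k := by
    obtain ⟨b⟩ := h.nonempty
    refine ⟨(negSet a (v b)).card, fun c => ?_⟩
    have := (hk' b).trans (hk' c).symm
    exact_mod_cast (mul_left_cancel₀ two_ne_zero this).symm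
  obtain ⟨b₁, c₁, hbc₁, hi₁⟩ := h.exists_inner_eq_pos hd
  obtain ⟨b₂, c₂, hbc₂, hi₂⟩ := h.exists_inner_eq_neg hd
  have hkd : 2 * (k : ℝ) = ρ * (ρ - 1) := by rw [← hk b₁, hk', hhalf]
  have hinter : ∀ b c, 4 * ((k : ℝ) - (negSet a (v b) ∩ negSet a (v c)).card) =
      ρ * (ρ - 1) * (1 - inner ℝ (v b) (v c)) := by
    intro b c
    have := h.card_sub_card_inter ((hk b).trans (hk c).symm)
    rwa [hk] at this
  have hpos : ∀ b c, inner ℝ (v b) (v c) = κ →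
      4 * ((k : ℝ) - (negSet a (v b) ∩ negSet a (v c)).card) = (ρ - 1) ^ 2 := by
    intro b c hbc
    rw [hinter, hbc]
    linear_combination -(ρ - 1) * h.mul_eq_one
  have hneg : ∀ b c, inner ℝ (v b) (v c) = -κ →
      4 * ((k : ℝ) - (negSet a (v b) ∩ negSet a (v c)).card) = ρ ^ 2 - 1 := by
    intro b c hbc
    rw [hinter, hbc]
    linear_combination (ρ - 1) * h.mul_eq_one
  -- the difference of the two intersection numbers is `(ρ - 1) / 2`
  obtain ⟨i, hi, hρ⟩ : ∃ i : ℕ, 1 ≤ i ∧ ρ = 2 * i + 1 := by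
    have h1 := hpos b₁ c₁ hi₁
    have h2 := hneg b₂ c₂ hi₂
    have hlt : (negSet a (v b₂) ∩ negSet a (v c₂)).card <
        (negSet a (v b₁) ∩ negSet a (v c₁)).card := by
      have : ((negSet a (v b₂) ∩ negSet a (v c₂)).card : ℝ) <
        (negSet a (v b₁) ∩ negSet a (v c₁)).card := by nlinarith
      exact_mod_cast this
    refine ⟨_, Nat.sub_pos_of_lt hlt, ?_⟩
    rw [Nat.cast_sub hlt.le]
    linear_combination (h1 - h2) / 2
  have hki : k = i * (2 * i + 1) := by
    have : (k : ℝ) = i * (2 * i + 1) := by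
      rw [hρ] at hkd
      linear_combination hkd / 2
    exact_mod_cast this
  have hmi : m + 1 = 2 * i * (2 * i + 1) := by
    have : ((m + 1 : ℕ) : ℝ) = 2 * i * (2 * i + 1) := by
      rw [hhalf, hρ]; ring
    exact_mod_cast this
  have hposi : ∀ b c, inner ℝ (v b) (v c) = κ →
      (negSet a (v b) ∩ negSet a (v c)).card = i ^ 2 + i := by
    intro b c hbc
    have h1 := hpos b c hbc
    rw [hρ, hki] at h1
    push_cast at h1
    have : ((negSet a (v b) ∩ negSet a (v c)).card : ℝ) = i ^ 2 + i := by
      linear_combination -h1 / 4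
    exact_mod_cast this
  have hnegi : ∀ b c, inner ℝ (v b) (v c) = -κ →
      (negSet a (v b) ∩ negSet a (v c)).card = i ^ 2 := by
    intro b c hbc
    have h1 := hneg b c hbc
    rw [hρ, hki] at h1
    push_cast at h1
    have : ((negSet a (v b) ∩ negSet a (v c)).card : ℝ) = i ^ 2 := by
      linear_combination -h1 / 4
    exact_mod_cast this
  -- deletion of the common point
  set N : β → Finset (Fin m) := fun b =>
    (negSet a (v b)).preimage Fin.succ (Fin.succ_injective m).injOn with hN
  have hmem : ∀ b j, j ∈ N b ↔ j.succ ∈ negSet a (v b) := fun b j => Finset.mem_preimage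
  have hdel : ∀ S : Finset (Fin (m + 1)), 0 ∈ S →
      (S.preimage Fin.succ (Fin.succ_injective m).injOn).card + 1 = S.card := by
    intro S hS
    have : S = insert 0 ((S.preimage Fin.succ (Fin.succ_injective m).injOn).map
        (Fin.succEmb m)) := by
      ext j
      refine Fin.cases ?_ (fun j => ?_) j
      · simp [hS]
      · simp [Fin.succ_ne_zero]
    conv_rhs => rw [this]
    rw [Finset.card_insert_of_notMem (by simp [Fin.succ_ne_zero]), Finset.card_map]
  have hNcard : ∀ b, (N b).card = k - 1 := fun b => by
    have := hdel _ (hzero b)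
    rw [hk] at this
    simp only [hN]
    omega
  have hNinter : ∀ b c, (N b ∩ N c).card + 1 = (negSet a (v b) ∩ negSet a (v c)).card := by
    intro b c
    rw [← hdel _ (Finset.mem_inter.mpr ⟨hzero b, hzero c⟩)]
    congr 2
    ext j
    simp [hmem]
  have hNinj : Function.Injective N := by
    intro b c hbc
    apply h.negSet_injective
    ext j
    refine Fin.cases ?_ (fun j => ?_) j
    · simp [hzero]
    · simp only [← hmem, hbc]
  have hsign : ∀ b j, blockSign (N b) j = blockSign (negSet a (v b)) j.succ := fun b j => by
    simp only [blockSign, hmem]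
  obtain ⟨s, hs⟩ := h.exists_sum_blockSign_mul
  obtain ⟨lam, hlam⟩ := exists_isDesign_of_sum_blockSign hNinj hNcard (r := -s) (m := s)
    (fun j => by
      rw [← hs 0 j.succ (Fin.succ_ne_zero j).symm, ← Finset.sum_neg_distrib]
      refine Finset.sum_congr rfl fun b _ => ?_
      rw [hsign, show blockSign (negSet a (v b)) 0 = -1 from if_pos (hzero b)]
      ring)
    (fun j j' hjj => by
      rw [← hs j.succ j'.succ fun h => hjj (Fin.succ_injective m h)]
      exact Finset.sum_congr rfl fun b _ => by rw [hsign, hsign])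
  rw [Fintype.card_fin] at hlam
  have hi' : (1 : ℝ) ≤ i := by exact_mod_cast hi
  have hm : (m : ℝ) = 2 * i * (2 * i + 1) - 1 := by
    have : ((m + 1 : ℕ) : ℝ) = 2 * i * (2 * i + 1) := by rw [hmi]; push_cast; ring
    push_cast at this
    linarith
  have hcard : (Fintype.card β : ℝ) = 2 * i * m := by
    have h1 := h.card_mul
    rw [hhalf, hρ] at h1
    have h2 : (2 * i + 1 : ℝ) ≠ 0 := by positivity
    apply mul_right_cancel₀ h2
    rw [hm]
    linear_combination h1
  have hk1 : k - 1 = (2 * i - 1) * (i + 1) := by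
    obtain ⟨j, rfl⟩ := Nat.exists_eq_add_of_le' hi
    rw [hki, show 2 * (j + 1) - 1 = 2 * j + 1 by omega]
    exact Nat.sub_eq_of_eq_add (by ring)
  have hlam' : lam = i * (2 * i ^ 2 + i - 2) := by
    have h1 := hlam.card_mul
    have hk1' : ((k - 1 : ℕ) : ℝ) = (2 * i - 1) * (i + 1) := by
      rw [hk1]
      push_cast [Nat.cast_sub (by omega : 1 ≤ 2 * i)]
      ring
    rw [Finset.card_image_of_injective _ hNinj, Finset.card_univ, hcard, hk1'] at h1
    have h2 : (m : ℝ) * (2 * ((2 * i - 1) * (i + 1))) ≠ 0 := by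
      rw [hm]
      have : 0 < 2 * (i : ℝ) * (2 * i + 1) - 1 := by nlinarith
      have : 0 < 2 * (i : ℝ) - 1 := by linarith
      positivity
    have h3 : (lam : ℝ) = i * (2 * i ^ 2 + i - 2) := by
      apply mul_left_cancel₀ h2
      rw [show (m : ℝ) * (m - 1) = m * (2 * ((2 * i - 1) * (i + 1))) by rw [hm]; ring] at h1
      linear_combination -h1
    have h4 : 2 ≤ 2 * i ^ 2 + i := by nlinarith
    have h5 : ((i * (2 * i ^ 2 + i - 2) : ℕ) : ℝ) = i * (2 * i ^ 2 + i - 2) := by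
      push_cast [Nat.cast_sub h4]
      ring
    exact_mod_cast h3.trans h5.symm
  have hsq : 1 ≤ i ^ 2 := Nat.one_le_pow _ _ hi
  refine ⟨i, hi, hρ, hhalf, ?_, ?_⟩
  · push_cast
    rw [hcard, hm, hρ]
    ring
  · rw [← hmi, Nat.add_sub_cancel, ← hk1, ← hlam']
    refine ⟨_, isQuasiSymmetricDesign_image hlam (by omega) hNinj ?_
      ⟨b₁, c₁, hbc₁, ?_⟩ ⟨b₂, c₂, hbc₂, ?_⟩⟩
    · intro b c hbc
      have := hNinter b c
      rcases h.inner_eq_or hbc with hi | hi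
      · left
        have := hposi b c hi
        omega
      · right
        have := hnegi b c hi
        omega
    · have := hNinter b₁ c₁
      have := hposi b₁ c₁ hi₁
      omega
    · have := hNinter b₂ c₂
      have := hnegi b₂ c₂ hi₂
      omega

theorem negSet_neg (h : IsSaturatedExtension a v κ ρ) (b : β) :
    negSet a (-v b) = (negSet a (v b))ᶜ := by
  ext i
  simp only [negSet, Finset.mem_filter, Finset.mem_univ, true_and, Finset.mem_compl,
    inner_neg_right, Left.neg_neg_iff, not_lt]
  refine ⟨le_of_lt, fun hle => lt_of_le_of_ne hle fun h0 => ?_⟩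
  have := h.abs_inner_frame i b
  rw [← h0, abs_zero] at this
  exact h.pos.ne this

/-- In dimension at least `4` there is always a design, of one kind if the blocks have `d / 2`
points and of the other kind if not. -/
theorem designCase (h : IsSaturatedExtension a v κ ρ) (hd : 4 ≤ d) :
    DesignCaseHalf d (d + Fintype.card β) ρ ∨ DesignCaseRoot d ρ := by
  by_cases hhalf : (d : ℝ) = ρ * (ρ - 1)
  · left
    obtain ⟨m, rfl⟩ : ∃ m, d = m + 1 := ⟨d - 1, by omega⟩
    have hσ : ∀ b, |if (0 : Fin (m + 1)) ∈ negSet a (v b) then (1 : ℝ) else -1| = 1 := fun b => by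
      split_ifs <;> norm_num
    refine (h.smul hσ).designCaseHalf hd hhalf fun b => ?_
    split_ifs with h0
    · rwa [one_smul]
    · rw [neg_one_smul, h.negSet_neg, Finset.mem_compl]
      exact h0
  · right
    -- sign the vectors so that the blocks have fewer than `d / 2` points
    have hσ : ∀ b, |if 2 * (negSet a (v b)).card ≤ d then (1 : ℝ) else -1| = 1 := fun b => by
      split_ifs <;> norm_num
    have h' := h.smul hσ
    have hle : ∀ b, 2 * (negSet a ((if 2 * (negSet a (v b)).card ≤ d then (1 : ℝ) else -1) •
        v b)).card ≤ d := by
      intro b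
      split_ifs with hb
      · rwa [one_smul]
      · rw [neg_one_smul, h.negSet_neg, Finset.card_compl, Fintype.card_fin]
        omega
    have hle' : ∀ b, (0 : ℝ) ≤ d - 2 * (negSet a ((if 2 * (negSet a (v b)).card ≤ d then (1 : ℝ)
        else -1) • v b)).card := fun b => by
      have : ((2 * (negSet a ((if 2 * (negSet a (v b)).card ≤ d then (1 : ℝ) else -1) •
        v b)).card : ℕ) : ℝ) ≤ d := by exact_mod_cast hle b
      push_cast at this
      linarith
    obtain ⟨b₀⟩ := h.nonempty
    refine h'.designCaseRoot hd (k := (negSet a ((if 2 * (negSet a (v b₀)).card ≤ d then (1 : ℝ)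
        else -1) • v b₀)).card) (fun b => ?_) fun h0 => hhalf ?_
    · have h1 := (h'.sq_sub_two_mul_card b).trans (h'.sq_sub_two_mul_card b₀).symm
      have h2 := (pow_left_inj₀ (hle' b) (hle' b₀) two_ne_zero).mp h1
      have h3 : ((negSet a ((if 2 * (negSet a (v b)).card ≤ d then (1 : ℝ) else -1) •
        v b)).card : ℝ) = (negSet a ((if 2 * (negSet a (v b₀)).card ≤ d then (1 : ℝ) else -1) •
        v b₀)).card := by linarith
      exact_mod_cast h3
    · have h1 := h'.sq_sub_two_mul_card b₀
      rw [h0] at h1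
      have h2 := h.one_lt_rho
      have h3 : ρ - 1 + d ≠ 0 := by
        have : (0 : ℝ) ≤ d := Nat.cast_nonneg d
        linarith
      have h4 := (mul_eq_zero.mp (h1.symm.trans (by norm_num))).resolve_left h3
      linarith

end IsSaturatedExtension

/-- A set of equiangular lines of largest possible incoherence that saturates the relative bound is
spanned by a simplex frame and further unit vectors. -/
theorem exists_isSaturatedExtension {d : ℕ} (hd : 2 ≤ d) {Ω : Set (Line d)} {κ ρ : ℝ} (hκ : 0 < κ)
    (hρ : ρ = κ⁻¹) (he : IsEquiangular Ω κ) (hs : SaturatesRelativeBound Ω κ) (hinc : Inc Ω = d) :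
    ∃ (m : ℕ) (a : Fin d → EuclideanSpace ℝ (Fin d)) (v : Fin m → EuclideanSpace ℝ (Fin d)),
      IsSaturatedExtension a v κ ρ ∧ Ω = linesThrough (Set.range (Sum.elim a v)) ∧
      Ω.ncard = d + m := by
  obtain ⟨Γ, hΓΩ, hΓ, hcard⟩ := exists_isIncoherent_of_Inc_eq (by omega) hinc
  obtain ⟨hlt, hfin, hn⟩ := hs
  obtain ⟨a, ha, hframe⟩ := exists_isSimplexFrame_of_isIncoherent hκ (he.mono hΓΩ) hΓ
  choose u hu using fun l : Line d => l.exists_isUnitVectorOf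
  have hΓfin := hfin.subset hΓΩ
  have hΓcard : Γ.ncard = d := by
    rw [Set.ncard, hcard, ENat.toNat_natCast]
  have hncard : (Ω \ Γ).ncard + d = Ω.ncard := by
    have := Set.ncard_sdiff_add_ncard_of_subset hΓΩ hfin
    rwa [hΓcard] at this
  have : Finite Γ := hΓfin
  have : Finite ↥(Ω \ Γ) := hfin.subset Set.sdiff_subset
  let e : Fin d ≃ Γ := (Finite.equivFinOfCardEq hΓcard).symm
  let e' : Fin (Ω \ Γ).ncard ≃ ↥(Ω \ Γ) := (Finite.equivFinOfCardEq rfl).symm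
  have hκρ : κ * ρ = 1 := by rw [hρ]; exact mul_inv_cancel₀ hκ.ne'
  have hd' : (2 : ℝ) ≤ d := by exact_mod_cast hd
  refine ⟨(Ω \ Γ).ncard, a ∘ e, fun b => u (e' b), ⟨?_, hd, hκ, hκρ, ?_, ?_, ?_, ?_, ?_⟩, ?_,
    by omega⟩
  · exact ⟨fun i => hframe.norm_eq_one _, fun i j hij =>
      hframe.inner_of_ne _ _ (e.injective.ne hij)⟩
  · have h1 : ρ ^ 2 * (κ ^ 2 * d) < ρ ^ 2 * 1 := by
      refine mul_lt_mul_of_pos_left hlt ?_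
      rw [hρ]
      positivity
    have h2 : ρ ^ 2 * (κ ^ 2 * d) = d := by
      linear_combination (d * (κ * ρ + 1)) * hκρ
    linarith
  · exact fun b => (hu _).2
  · intro i b
    refine he _ (hΓΩ (e i).2) _ (e' b).2.1 (fun h => ?_) _ _ (ha _) (hu _)
    exact (e' b).2.2 (h ▸ (e i).2)
  · intro b c hbc
    exact he _ (e' b).2.1 _ (e' c).2.1 (fun h => hbc (e'.injective (Subtype.ext h))) _ _ (hu _)
      (hu _)
  · rw [eq_div_iff (by linarith), ← hncard] at hn
    rw [Fintype.card_fin]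
    push_cast at hn
    linear_combination ρ ^ 2 * hn + ((Ω \ Γ).ncard * d * (κ * ρ + 1) + d * (d - 1) * (κ * ρ + 1)) *
      hκρ
  · ext l
    constructor
    · intro hl
      by_cases hlΓ : l ∈ Γ
      · refine ⟨a ⟨l, hlΓ⟩, ⟨Sum.inl (e.symm ⟨l, hlΓ⟩), by simp⟩, (ha ⟨l, hlΓ⟩).ne_zero,
          (ha ⟨l, hlΓ⟩).1⟩
      · exact ⟨u l, ⟨Sum.inr (e'.symm ⟨l, hl, hlΓ⟩), by simp⟩, (hu l).ne_zero, (hu l).1⟩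
    · rintro ⟨_, ⟨i | b, rfl⟩, h0, hl⟩
      · rw [← Line.eq_of_mem h0 (ha _).1 hl]
        exact hΓΩ (e i).2
      · rw [← Line.eq_of_mem h0 (hu _).1 hl]
        exact (e' b).2.1

/-! ### The hexagon and the icosahedron -/

theorem linesThrough_subset_of_smul_mem {d : ℕ} {X Y : Set (EuclideanSpace ℝ (Fin d))}
    (h : ∀ x ∈ X, ∃ c : ℝ, c ≠ 0 ∧ c • x ∈ Y) : linesThrough X ⊆ linesThrough Y := by
  rintro l ⟨x, hx, hx0, hxl⟩
  obtain ⟨c, hc, hcx⟩ := h x hx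
  exact ⟨c • x, hcx, smul_ne_zero hc hx0, Submodule.smul_mem _ _ hxl⟩

theorem IsSimplexFrame.map {ι E F : Type*} [NormedAddCommGroup E] [InnerProductSpace ℝ E]
    [NormedAddCommGroup F] [InnerProductSpace ℝ F] {a : ι → E} {κ : ℝ} (h : IsSimplexFrame a κ)
    (f : E ≃ₗᵢ[ℝ] F) : IsSimplexFrame (fun i => f (a i)) κ :=
  ⟨fun i => by rw [f.norm_map, h.norm_eq_one], fun i j hij => by
    rw [f.inner_map_map, h.inner_of_ne i j hij]⟩

theorem IsSimplexFrame.exists_linearIsometryEquiv {d : ℕ} [NeZero d]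
    {a b : Fin d → EuclideanSpace ℝ (Fin d)} {κ : ℝ} (ha : IsSimplexFrame a κ)
    (hb : IsSimplexFrame b κ) (h0 : 0 ≤ κ) (h1 : κ < 1) :
    ∃ f : EuclideanSpace ℝ (Fin d) ≃ₗᵢ[ℝ] EuclideanSpace ℝ (Fin d), ∀ i, f (a i) = b i :=
  exists_linearIsometryEquiv_of_inner_eq (ha.linearIndependent h0 h1) (by simp) rfl fun i j => by
    rw [ha.inner_eq_ite, hb.inner_eq_ite]

theorem IsSimplexFrame.isIncoherent {d : ℕ} {J : Type*} {a : J → EuclideanSpace ℝ (Fin d)} {κ : ℝ}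
    (ha : IsSimplexFrame a κ) (h0 : 0 < κ) : IsIncoherent (linesThrough (Set.range a)) := by
  classical
  refine isIncoherent_linesThrough_range fun j k => ?_
  rw [ha.inner_eq_ite]
  split_ifs
  · exact one_pos
  · exact h0

theorem IsSimplexFrame.encard_linesThrough {d : ℕ} {J : Type*} {a : J → EuclideanSpace ℝ (Fin d)}
    {κ : ℝ} (ha : IsSimplexFrame a κ) (h0 : 0 < κ) (h1 : κ < 1) :
    (linesThrough (Set.range a)).encard = ENat.card J :=
  encard_linesThrough_range_of_abs_inner_lt ha.norm_eq_one fun j k hjk => by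
    rw [ha.inner_of_ne j k hjk, abs_of_pos h0]
    exact h1

/-- A simplex frame of `d` vectors gives an incoherent set of the largest possible size. -/
theorem IsSimplexFrame.Inc_eq {d : ℕ} {a : Fin d → EuclideanSpace ℝ (Fin d)} {κ κ' : ℝ}
    (ha : IsSimplexFrame a κ') (h0' : 0 < κ') (h1' : κ' < 1) (h0 : 0 < κ) (h1 : κ < 1)
    {Ω : Set (Line d)} (he : IsEquiangular Ω κ) (hfin : Ω.Finite)
    (hsub : linesThrough (Set.range a) ⊆ Ω) : Inc Ω = d :=
  Inc_eq_of_le_encard h0 h1 he hfin hsub (ha.isIncoherent h0')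
    (by rw [ha.encard_linesThrough h0' h1']; simp)

theorem SaturatesRelativeBound.lt_one {d : ℕ} (hd : 2 ≤ d) {Ω : Set (Line d)} {κ : ℝ}
    (h : SaturatesRelativeBound Ω κ) : κ < 1 := by
  have h1 := h.1
  have h2 : (2 : ℝ) ≤ d := by exact_mod_cast hd
  by_contra hle
  have : 1 ≤ κ ^ 2 := one_le_pow₀ (not_lt.mp hle)
  nlinarith

/-- Two adjacent vertices of the regular hexagon. -/
noncomputable def hexagonFrame : Fin 2 → EuclideanSpace ℝ (Fin 2) :=
  ![!₂[1, 0], !₂[1 / 2, √3 / 2]]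

theorem isSimplexFrame_hexagonFrame : IsSimplexFrame hexagonFrame (1 / 2) := by
  have h3 : √3 ^ 2 = 3 := Real.sq_sqrt (by norm_num)
  refine ⟨fun i => ?_, fun i j hij => ?_⟩
  · rw [EuclideanSpace.norm_eq, Real.sqrt_eq_one]
    fin_cases i
    · simp [hexagonFrame, Fin.sum_univ_two]
    · simp [hexagonFrame, Fin.sum_univ_two, div_pow, h3]; norm_num
  · fin_cases i <;> fin_cases j <;> first | exact absurd rfl hij | skip
    all_goals simp [hexagonFrame, PiLp.inner_apply, Fin.sum_univ_two]

theorem mem_hexagonVertices {x : EuclideanSpace ℝ (Fin 2)} :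
    x ∈ hexagonVertices ↔ (x = hexagonFrame 0 ∨ x = -hexagonFrame 0) ∨
      (x = hexagonFrame 1 ∨ x = -hexagonFrame 1) ∨
      (x = hexagonFrame 1 - hexagonFrame 0 ∨ x = -(hexagonFrame 1 - hexagonFrame 0)) := by
  have hv : ∀ θ : ℝ, (!₂[Real.cos (θ + Real.pi), Real.sin (θ + Real.pi)] :
      EuclideanSpace ℝ (Fin 2)) = -!₂[Real.cos θ, Real.sin θ] := fun θ => by
    ext i
    fin_cases i <;> simp
  have e0 : (!₂[Real.cos ((0 : ℕ) * (Real.pi / 3)), Real.sin ((0 : ℕ) * (Real.pi / 3))] :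
      EuclideanSpace ℝ (Fin 2)) = hexagonFrame 0 := by
    ext i
    fin_cases i <;> simp [hexagonFrame]
  have e1 : (!₂[Real.cos ((1 : ℕ) * (Real.pi / 3)), Real.sin ((1 : ℕ) * (Real.pi / 3))] :
      EuclideanSpace ℝ (Fin 2)) = hexagonFrame 1 := by
    ext i
    fin_cases i <;> simp [hexagonFrame]
  have e2 : (!₂[Real.cos ((2 : ℕ) * (Real.pi / 3)), Real.sin ((2 : ℕ) * (Real.pi / 3))] :
      EuclideanSpace ℝ (Fin 2)) = hexagonFrame 1 - hexagonFrame 0 := by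
    rw [show ((2 : ℕ) : ℝ) * (Real.pi / 3) = Real.pi - Real.pi / 3 by push_cast; ring]
    ext i
    fin_cases i
    · simp [hexagonFrame]; norm_num
    · simp [hexagonFrame]
  have e3 := hv ((0 : ℕ) * (Real.pi / 3))
  rw [e0, show ((0 : ℕ) : ℝ) * (Real.pi / 3) + Real.pi = (3 : ℕ) * (Real.pi / 3) by
    push_cast; ring] at e3
  have e4 := hv ((1 : ℕ) * (Real.pi / 3))
  rw [e1, show ((1 : ℕ) : ℝ) * (Real.pi / 3) + Real.pi = (4 : ℕ) * (Real.pi / 3) by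
    push_cast; ring] at e4
  have e5 := hv ((2 : ℕ) * (Real.pi / 3))
  rw [e2, show ((2 : ℕ) : ℝ) * (Real.pi / 3) + Real.pi = (5 : ℕ) * (Real.pi / 3) by
    push_cast; ring] at e5
  constructor
  · rintro ⟨j, rfl⟩
    fin_cases j
    · exact Or.inl (Or.inl e0)
    · exact Or.inr (Or.inl (Or.inl e1))
    · exact Or.inr (Or.inr (Or.inl e2))
    · exact Or.inl (Or.inr e3)
    · exact Or.inr (Or.inl (Or.inr e4))
    · exact Or.inr (Or.inr (Or.inr e5))
  · rintro ((rfl | rfl) | (rfl | rfl) | (rfl | rfl))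
    · exact ⟨0, e0.symm⟩
    · exact ⟨3, e3.symm⟩
    · exact ⟨1, e1.symm⟩
    · exact ⟨4, e4.symm⟩
    · exact ⟨2, e2.symm⟩
    · exact ⟨5, e5.symm⟩

theorem IsThreeLinesInPlane.Inc_eq {d : ℕ} {Ω : Set (Line d)} {κ : ℝ} (hκ : 0 < κ)
    (he : IsEquiangular Ω κ) (hs : SaturatesRelativeBound Ω κ) (h : IsThreeLinesInPlane Ω) :
    Inc Ω = d := by
  obtain ⟨rfl, f, rfl⟩ := h
  refine (isSimplexFrame_hexagonFrame.map f).Inc_eq (by norm_num) (by norm_num) hκ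
    (hs.lt_one le_rfl) he hs.2.1 (linesThrough_subset_of_smul_mem ?_)
  rintro _ ⟨i, rfl⟩
  refine ⟨1, one_ne_zero, hexagonFrame i, ?_, by simp⟩
  rw [mem_hexagonVertices]
  fin_cases i <;> simp

/-- Three mutually adjacent vertices of the regular icosahedron. -/
noncomputable def icosahedronFrame : Fin 3 → EuclideanSpace ℝ (Fin 3) :=
  ![!₂[0, 1, Real.goldenRatio], !₂[1, Real.goldenRatio, 0], !₂[Real.goldenRatio, 0, 1]]

/-- Representatives of the other three diagonals of the icosahedron; the inner product of the `j`-th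
one with the `j`-th vector of `icosahedronFrame` is negative. -/
noncomputable def icosahedronRest : Fin 3 → EuclideanSpace ℝ (Fin 3) :=
  ![!₂[Real.goldenRatio, 0, -1], !₂[0, -1, Real.goldenRatio], !₂[-1, Real.goldenRatio, 0]]

theorem inner_icosahedronFrame (i j : Fin 3) :
    inner ℝ (icosahedronFrame i) (icosahedronFrame j) =
      if i = j then Real.goldenRatio + 2 else Real.goldenRatio := by
  have h := Real.goldenRatio_sq
  fin_cases i <;> fin_cases j <;>
    simp [icosahedronFrame, PiLp.inner_apply, EuclideanSpace.real_norm_sq_eq,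
      Fin.sum_univ_three] <;> nlinarith

theorem inner_icosahedronFrame_icosahedronRest (i j : Fin 3) :
    inner ℝ (icosahedronFrame i) (icosahedronRest j) =
      Real.goldenRatio * blockSign {j} i := by
  have h := Real.goldenRatio_sq
  fin_cases i <;> fin_cases j <;>
    simp [icosahedronFrame, icosahedronRest, blockSign, PiLp.inner_apply, Fin.sum_univ_three] <;>
    nlinarith

/-- With `κ = 1 / √5`, and vertices normalised by their common norm `√(φ + 2)`. -/
theorem isSimplexFrame_icosahedronFrame :
    IsSimplexFrame (fun i => (√(Real.goldenRatio + 2))⁻¹ • icosahedronFrame i) (√5)⁻¹ := by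
  have hφ := Real.goldenRatio_pos
  have hs : √(Real.goldenRatio + 2) ^ 2 = Real.goldenRatio + 2 := Real.sq_sqrt (by linarith)
  have hs0 : √(Real.goldenRatio + 2) ≠ 0 := (Real.sqrt_pos.mpr (by linarith)).ne'
  have h5 : √5 ^ 2 = 5 := Real.sq_sqrt (by norm_num)
  have h50 : √5 ≠ 0 := (Real.sqrt_pos.mpr (by norm_num)).ne'
  refine ⟨fun i => ?_, fun i j hij => ?_⟩
  · rw [← pow_eq_one_iff_of_nonneg (norm_nonneg _) two_ne_zero, ← real_inner_self_eq_norm_sq,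
      real_inner_smul_left, real_inner_smul_right, inner_icosahedronFrame, if_pos rfl,
      ← mul_assoc, ← mul_inv, ← sq, hs]
    exact inv_mul_cancel₀ (by linarith)
  · rw [real_inner_smul_left, real_inner_smul_right, inner_icosahedronFrame, if_neg hij]
    rw [← mul_assoc, ← mul_inv, ← sq, hs, Real.goldenRatio]
    field_simp
    linear_combination h5

theorem mem_icosahedronVertices {x : EuclideanSpace ℝ (Fin 3)} :
    x ∈ icosahedronVertices ↔ (∃ i, x = icosahedronFrame i ∨ x = -icosahedronFrame i) ∨
      ∃ i, x = icosahedronRest i ∨ x = -icosahedronRest i := by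
  have hneg : ∀ a b c : ℝ, -(!₂[a, b, c] : EuclideanSpace ℝ (Fin 3)) = !₂[-a, -b, -c] := by
    intro a b c
    ext i
    fin_cases i <;> simp
  constructor
  · rintro ⟨a, b, rfl | rfl, rfl | rfl, rfl | rfl | rfl⟩
    · exact Or.inl ⟨0, Or.inl rfl⟩
    · exact Or.inl ⟨1, Or.inl rfl⟩
    · exact Or.inl ⟨2, Or.inl rfl⟩
    · exact Or.inr ⟨1, Or.inr (by simp [icosahedronRest, hneg])⟩
    · exact Or.inr ⟨2, Or.inr (by simp [icosahedronRest, hneg])⟩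
    · exact Or.inr ⟨0, Or.inr (by simp [icosahedronRest, hneg])⟩
    · exact Or.inr ⟨1, Or.inl rfl⟩
    · exact Or.inr ⟨2, Or.inl rfl⟩
    · exact Or.inr ⟨0, Or.inl rfl⟩
    · exact Or.inl ⟨0, Or.inr (by simp [icosahedronFrame, hneg])⟩
    · exact Or.inl ⟨1, Or.inr (by simp [icosahedronFrame, hneg])⟩
    · exact Or.inl ⟨2, Or.inr (by simp [icosahedronFrame, hneg])⟩
  · rintro (⟨i, rfl | rfl⟩ | ⟨i, rfl | rfl⟩) <;> fin_cases i
    · exact ⟨1, _, Or.inl rfl, Or.inl rfl, Or.inl rfl⟩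
    · exact ⟨1, _, Or.inl rfl, Or.inl rfl, Or.inr (Or.inl rfl)⟩
    · exact ⟨1, _, Or.inl rfl, Or.inl rfl, Or.inr (Or.inr rfl)⟩
    · exact ⟨-1, _, Or.inr rfl, Or.inr rfl, Or.inl (by simp [icosahedronFrame, hneg])⟩
    · exact ⟨-1, _, Or.inr rfl, Or.inr rfl, Or.inr (Or.inl (by simp [icosahedronFrame, hneg]))⟩
    · exact ⟨-1, _, Or.inr rfl, Or.inr rfl, Or.inr (Or.inr (by simp [icosahedronFrame, hneg]))⟩
    · exact ⟨-1, _, Or.inr rfl, Or.inl rfl, Or.inr (Or.inr rfl)⟩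
    · exact ⟨-1, _, Or.inr rfl, Or.inl rfl, Or.inl rfl⟩
    · exact ⟨-1, _, Or.inr rfl, Or.inl rfl, Or.inr (Or.inl rfl)⟩
    · exact ⟨1, _, Or.inl rfl, Or.inr rfl, Or.inr (Or.inr (by simp [icosahedronRest, hneg]))⟩
    · exact ⟨1, _, Or.inl rfl, Or.inr rfl, Or.inl (by simp [icosahedronRest, hneg])⟩
    · exact ⟨1, _, Or.inl rfl, Or.inr rfl, Or.inr (Or.inl (by simp [icosahedronRest, hneg]))⟩

theorem IsSixLinesInSpace.Inc_eq {d : ℕ} {Ω : Set (Line d)} {κ : ℝ} (hκ : 0 < κ)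
    (he : IsEquiangular Ω κ) (hs : SaturatesRelativeBound Ω κ) (h : IsSixLinesInSpace Ω) :
    Inc Ω = d := by
  obtain ⟨rfl, f, rfl⟩ := h
  have hφ := Real.goldenRatio_pos
  have hs0 : √(Real.goldenRatio + 2) ≠ 0 := (Real.sqrt_pos.mpr (by linarith)).ne'
  refine (isSimplexFrame_icosahedronFrame.map f).Inc_eq (by positivity)
    (inv_lt_one_of_one_lt₀ (Real.lt_sqrt_of_sq_lt (by norm_num))) hκ
    (hs.lt_one (by norm_num)) he hs.2.1 (linesThrough_subset_of_smul_mem ?_)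
  rintro _ ⟨i, rfl⟩
  refine ⟨√(Real.goldenRatio + 2), hs0, icosahedronFrame i,
    mem_icosahedronVertices.mpr (Or.inl ⟨i, Or.inl rfl⟩), ?_⟩
  simp only [map_smul, smul_smul, mul_inv_cancel₀ hs0, one_smul]

namespace IsSaturatedExtension

theorem isThreeLinesInPlane {m : ℕ} {a : Fin 2 → EuclideanSpace ℝ (Fin 2)}
    {v : Fin m → EuclideanSpace ℝ (Fin 2)} {κ ρ : ℝ} (h : IsSaturatedExtension a v κ ρ) :
    IsThreeLinesInPlane (linesThrough (Set.range (Sum.elim a v))) := by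
  obtain ⟨b₀⟩ := h.nonempty
  have hone := h.one_lt_rho
  have hsq : ∀ b, (2 - 2 * ((negSet a (v b)).card : ℝ)) ^ 2 = (ρ + 1) ^ 2 * (2 - ρ) := fun b => by
    have := h.sq_sub_two_mul_card b
    push_cast at this
    linear_combination this
  have hcard : ∀ b, (negSet a (v b)).card = 1 := by
    intro b
    have h1 : (negSet a (v b)).card ≤ 2 := by simpa using Finset.card_le_univ (negSet a (v b))
    have h2 := hsq b
    have h3 : 0 < (ρ - 1) ^ 2 * (ρ + 2) := mul_pos (by nlinarith) (by linarith)
    interval_cases (negSet a (v b)).card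
    · norm_num at h2; nlinarith
    · rfl
    · norm_num at h2; nlinarith
  have hρ : ρ = 2 := by
    have h1 := hsq b₀
    rw [hcard] at h1
    norm_num at h1
    rcases h1 with h1 | h1 <;> linarith
  have hκ : κ = 1 / 2 := by
    have := h.mul_eq_one
    rw [hρ] at this
    linarith
  have hv : ∀ b, v b = a 1 - a 0 ∨ v b = -(a 1 - a 0) := by
    intro b
    obtain ⟨j, hj⟩ := Finset.card_eq_one.mp (hcard b)
    have hin : ∀ i, inner ℝ (a i) (v b) = (κ * blockSign {j} i : ℝ) := fun i => by
      rw [h.inner_frame, hj]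
    have hli := h.frame.linearIndependent h.pos.le h.lt_one
    fin_cases j
    · left
      refine eq_of_inner_frame_eq hli (by simp) fun i => ?_
      rw [hin, inner_sub_right, h.frame.inner_eq_ite, h.frame.inner_eq_ite, hκ]
      fin_cases i <;> simp [blockSign] <;> norm_num
    · right
      refine eq_of_inner_frame_eq hli (by simp) fun i => ?_
      rw [hin, inner_neg_right, inner_sub_right, h.frame.inner_eq_ite, h.frame.inner_eq_ite, hκ]
      fin_cases i <;> simp [blockSign] <;> norm_num
  have hframe := h.frame
  rw [hκ] at hframe
  obtain ⟨f, hf⟩ := isSimplexFrame_hexagonFrame.exists_linearIsometryEquiv hframe (by norm_num)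
    (by norm_num)
  refine ⟨rfl, f, subset_antisymm (linesThrough_subset_of_smul_mem ?_)
    (linesThrough_subset_of_smul_mem ?_)⟩
  · rintro _ ⟨i | b, rfl⟩
    · refine ⟨1, one_ne_zero, hexagonFrame i, ?_, by simp [hf]⟩
      rw [mem_hexagonVertices]
      fin_cases i <;> simp
    · rcases hv b with hb | hb
      · refine ⟨1, one_ne_zero, hexagonFrame 1 - hexagonFrame 0, ?_, by simp [hf, hb]⟩
        rw [mem_hexagonVertices]; simp
      · refine ⟨-1, by norm_num, hexagonFrame 1 - hexagonFrame 0, ?_, by simp [hf, hb]⟩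
        rw [mem_hexagonVertices]; simp
  · rintro _ ⟨x, hx, rfl⟩
    rcases mem_hexagonVertices.mp hx with (rfl | rfl) | (rfl | rfl) | hx
    · exact ⟨1, one_ne_zero, Sum.inl 0, by simp [hf]⟩
    · exact ⟨-1, by norm_num, Sum.inl 0, by simp [hf]⟩
    · exact ⟨1, one_ne_zero, Sum.inl 1, by simp [hf]⟩
    · exact ⟨-1, by norm_num, Sum.inl 1, by simp [hf]⟩
    · rcases hx with rfl | rfl <;> rcases hv b₀ with hb | hb
      · exact ⟨1, one_ne_zero, Sum.inr b₀, by simp [hf, hb]⟩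
      · exact ⟨-1, by norm_num, Sum.inr b₀, by simp [hf, hb]⟩
      · exact ⟨-1, by norm_num, Sum.inr b₀, by simp [hf, hb]⟩
      · exact ⟨1, one_ne_zero, Sum.inr b₀, by simp [hf, hb]⟩

theorem isSixLinesInSpace {m : ℕ} {a : Fin 3 → EuclideanSpace ℝ (Fin 3)}
    {v : Fin m → EuclideanSpace ℝ (Fin 3)} {κ ρ : ℝ} (h : IsSaturatedExtension a v κ ρ) :
    IsSixLinesInSpace (linesThrough (Set.range (Sum.elim a v))) := by
  obtain ⟨b₀⟩ := h.nonempty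
  have hone := h.one_lt_rho
  have hsq : ∀ b, (3 - 2 * ((negSet a (v b)).card : ℝ)) ^ 2 = (ρ + 2) * (3 - ρ * (ρ - 1)) :=
    fun b => by
      have := h.sq_sub_two_mul_card b
      push_cast at this
      linear_combination this
  have hcard : ∀ b, (negSet a (v b)).card = 1 ∨ (negSet a (v b)).card = 2 := by
    intro b
    have h1 : (negSet a (v b)).card ≤ 3 := by simpa using Finset.card_le_univ (negSet a (v b))
    have h2 := hsq b
    have h3 : 0 < (ρ - 1) ^ 2 * (ρ + 3) := mul_pos (by nlinarith) (by linarith)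
    interval_cases (negSet a (v b)).card
    · norm_num at h2; nlinarith
    · left; rfl
    · right; rfl
    · norm_num at h2; nlinarith
  have hρ2 : ρ ^ 2 = 5 := by
    have h1 : (1 : ℝ) = (ρ + 2) * (3 - ρ * (ρ - 1)) := by
      rw [← hsq b₀]
      rcases hcard b₀ with h1 | h1 <;> rw [h1] <;> norm_num
    have h2 : (ρ + 1) * (ρ ^ 2 - 5) = 0 := by linear_combination h1
    have := (mul_eq_zero.mp h2).resolve_left (by linarith)
    linarith
  have hρ : ρ = √5 := by
    rw [← hρ2, Real.sqrt_sq h.rho_pos.le]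
  have hκ : κ = (√5)⁻¹ := by
    rw [← hρ]
    exact eq_inv_of_mul_eq_one_left h.mul_eq_one
  have hm : m = 3 := by
    have := h.card_mul
    rw [hρ2, Fintype.card_fin] at this
    have : (m : ℝ) = 3 := by push_cast at this; linarith
    exact_mod_cast this
  have hφ := Real.goldenRatio_pos
  set s := √(Real.goldenRatio + 2) with hsdef
  have hs : s ^ 2 = Real.goldenRatio + 2 := Real.sq_sqrt (by linarith)
  have hs0 : s ≠ 0 := (Real.sqrt_pos.mpr (by linarith)).ne'
  have hframe := h.frame
  rw [hκ] at hframe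
  obtain ⟨f, hf⟩ := isSimplexFrame_icosahedronFrame.exists_linearIsometryEquiv hframe
    (by positivity) (by rw [← hκ]; exact h.lt_one)
  have hf' : ∀ i, f (icosahedronFrame i) = s • a i := fun i => by
    rw [← hf, map_smul, smul_smul, mul_inv_cancel₀ hs0, one_smul]
  -- a block is a point or the complement of a point
  have hrest : ∀ i j, inner ℝ (a i) (f (s⁻¹ • icosahedronRest j)) = κ * blockSign {j} i := by
    intro i j
    have h5 : √5 ^ 2 = 5 := Real.sq_sqrt (by norm_num)
    have h50 : √5 ≠ 0 := (Real.sqrt_pos.mpr (by norm_num)).ne'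
    rw [← hf, f.inner_map_map, real_inner_smul_left, real_inner_smul_right,
      inner_icosahedronFrame_icosahedronRest, ← mul_assoc, ← mul_assoc, ← mul_inv, ← hsdef, ← sq,
      hs, hκ, Real.goldenRatio]
    congr 1
    field_simp
    linear_combination h5
  have hli := h.frame.linearIndependent h.pos.le h.lt_one
  have hv : ∀ b, ∃ j, ∃ c : ℝ, (c = 1 ∨ c = -1) ∧ v b = c • f (s⁻¹ • icosahedronRest j) := by
    intro b
    rcases hcard b with h1 | h1
    · obtain ⟨j, hj⟩ := Finset.card_eq_one.mp h1
      refine ⟨j, 1, Or.inl rfl, eq_of_inner_frame_eq hli (by simp) fun i => ?_⟩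
      rw [h.inner_frame, one_smul, hrest, hj]
    · have h2 : (negSet a (v b))ᶜ.card = 1 := by
        rw [Finset.card_compl, h1, Fintype.card_fin]
      obtain ⟨j, hj⟩ := Finset.card_eq_one.mp h2
      refine ⟨j, -1, Or.inr rfl, eq_of_inner_frame_eq hli (by simp) fun i => ?_⟩
      rw [h.inner_frame, real_inner_smul_right, hrest, ← hj]
      simp only [blockSign, Finset.mem_compl]
      split_ifs <;> simp
  choose J c hc hJ using hv
  have hinj : Function.Injective J := by
    intro b b' hbb
    by_contra hne
    have h1 := h.abs_inner b b' hne
    have h2 : v b = v b' ∨ v b = -v b' := by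
      rw [hJ b, hJ b', hbb]
      rcases hc b with h3 | h3 <;> rcases hc b' with h4 | h4 <;> rw [h3, h4] <;> simp
    have h3 := h.lt_one
    rcases h2 with h2 | h2 <;> rw [h2] at h1
    · rw [real_inner_self_eq_norm_sq, h.norm_eq_one] at h1
      norm_num at h1
      linarith
    · rw [inner_neg_left, real_inner_self_eq_norm_sq, h.norm_eq_one] at h1
      norm_num at h1
      linarith
  have hsurj : Function.Surjective J := by
    subst hm
    exact Finite.surjective_of_injective hinj
  have hc0 : ∀ b, c b ≠ 0 := fun b => by
    rcases hc b with h3 | h3 <;> rw [h3] <;> norm_num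
  refine ⟨rfl, f, subset_antisymm (linesThrough_subset_of_smul_mem ?_)
    (linesThrough_subset_of_smul_mem ?_)⟩
  · rintro _ ⟨i | b, rfl⟩
    · exact ⟨s, hs0, icosahedronFrame i, mem_icosahedronVertices.mpr (Or.inl ⟨i, Or.inl rfl⟩), by
        simp [hf']⟩
    · refine ⟨s * (c b)⁻¹, mul_ne_zero hs0 (inv_ne_zero (hc0 b)), icosahedronRest (J b),
        mem_icosahedronVertices.mpr (Or.inr ⟨_, Or.inl rfl⟩), ?_⟩
      rw [Sum.elim_inr, hJ b, map_smul, smul_smul, smul_smul, mul_assoc, mul_assoc,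
        inv_mul_cancel_left₀ (hc0 b), mul_inv_cancel₀ hs0, one_smul]
  · rintro _ ⟨x, hx, rfl⟩
    rcases mem_icosahedronVertices.mp hx with ⟨i, rfl | rfl⟩ | ⟨i, hx⟩
    · refine ⟨s⁻¹, inv_ne_zero hs0, Sum.inl i, ?_⟩
      rw [hf', smul_smul, inv_mul_cancel₀ hs0, one_smul, Sum.elim_inl]
    · refine ⟨-s⁻¹, neg_ne_zero.mpr (inv_ne_zero hs0), Sum.inl i, ?_⟩
      rw [map_neg, hf', smul_neg, neg_smul, neg_neg, smul_smul, inv_mul_cancel₀ hs0, one_smul,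
        Sum.elim_inl]
    · obtain ⟨b, rfl⟩ := hsurj i
      rcases hx with rfl | rfl
      · refine ⟨c b * s⁻¹, mul_ne_zero (hc0 b) (inv_ne_zero hs0), Sum.inr b, ?_⟩
        rw [Sum.elim_inr, hJ b, map_smul, smul_smul]
      · refine ⟨-(c b * s⁻¹), neg_ne_zero.mpr (mul_ne_zero (hc0 b) (inv_ne_zero hs0)),
          Sum.inr b, ?_⟩
        rw [Sum.elim_inr, hJ b, map_smul, smul_smul, map_neg, smul_neg, neg_smul, neg_neg]

end IsSaturatedExtension

/-! ### Lines from designs -/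

/-- From blocks with the numerical properties of a suitable design one obtains equiangular lines:
each block prescribes the signs of the inner products of a unit vector with the members of a simplex
frame. -/
theorem exists_lines_of_blocks {d : ℕ} (hd : 2 ≤ d) {κ ρ : ℝ} (hκ : 0 < κ) (hκρ : κ * ρ = 1)
    (hlt : d < ρ ^ 2) {B : Finset (Finset (Fin d))} {k : ℕ} (hk : ∀ b ∈ B, b.card = k)
    (hroot : 4 * (k : ℝ) ^ 2 - 4 * d * k + (ρ - 1) ^ 2 * (d + ρ) = 0)
    (hinter : ∀ b ∈ B, ∀ c ∈ B, b ≠ c →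
      ((b ∩ c).card : ℝ) = k - (ρ - 1) ^ 2 / 4 ∨ ((b ∩ c).card : ℝ) = k - (ρ ^ 2 - 1) / 4)
    (hB : (B.card : ℝ) * (ρ ^ 2 - d) = d * (d - 1)) :
    ∃ Ω : Set (Line d), IsEquiangular Ω κ ∧ SaturatesRelativeBound Ω κ ∧ Ω.ncard = d + B.card ∧
      Inc Ω = d := by
  have hd' : (2 : ℝ) ≤ d := by exact_mod_cast hd
  have hρ0 : 0 < ρ := (mul_pos_iff_of_pos_left hκ).mp (by rw [hκρ]; exact one_pos)
  have hρ1 : 1 < ρ := by nlinarith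
  have hκ1 : κ < 1 := by nlinarith
  obtain ⟨a, ha⟩ := exists_isSimplexFrame d (by omega) hκ.le hκ1
  let w : Finset (Fin d) → EuclideanSpace ℝ (Fin d) := fun b =>
    simplexDual a κ fun i => κ * blockSign b i
  have hw : ∀ b i, inner ℝ (a i) (w b) = κ * blockSign b i := fun b i =>
    ha.inner_simplexDual hκ.le hκ1 _ i
  -- up to a positive factor the inner product only depends on the size of the intersection
  have hww : ∀ b ∈ B, ∀ c ∈ B,
      ρ * (ρ - 1) * inner ℝ (w b) (w c) = ρ * (ρ - 1) - 4 * (k - ((b ∩ c).card : ℝ)) := by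
    intro b hb c hc
    have key := ha.inner_of_blockSign hκ hκ1 hκρ (hw b) (hw c)
    rw [hk b hb, hk c hc] at key
    have hpos : ρ - 1 + d ≠ 0 := by linarith
    apply mul_left_cancel₀ hpos
    linear_combination key - hroot
  have hρρ : ρ * (ρ - 1) ≠ 0 := mul_ne_zero hρ0.ne' (by linarith)
  have hnorm : ∀ b ∈ B, ‖w b‖ = 1 := by
    intro b hb
    have h1 := hww b hb b hb
    rw [Finset.inter_self, hk b hb, sub_self, mul_zero, sub_zero, real_inner_self_eq_norm_sq] at h1
    exact (pow_eq_one_iff_of_nonneg (norm_nonneg _) two_ne_zero).mp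
      (mul_left_cancel₀ hρρ (h1.trans (mul_one _).symm))
  have habs : ∀ b ∈ B, ∀ c ∈ B, b ≠ c → |(inner ℝ (w b) (w c) : ℝ)| = κ := by
    intro b hb c hc hbc
    rw [abs_eq hκ.le]
    have h1 := hww b hb c hc
    rcases hinter b hb c hc hbc with h2 | h2 <;> rw [h2] at h1
    · left
      apply mul_left_cancel₀ hρρ
      linear_combination h1 - (ρ - 1) * hκρ
    · right
      apply mul_left_cancel₀ hρρ
      linear_combination h1 + (ρ - 1) * hκρ
  set u : Fin d ⊕ B → EuclideanSpace ℝ (Fin d) := Sum.elim a fun b => w b with hu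
  have hu1 : ∀ j, ‖u j‖ = 1 := by
    rintro (i | b)
    · exact ha.norm_eq_one i
    · exact hnorm b b.2
  have habsa : ∀ b i, |(inner ℝ (a i) (w b) : ℝ)| = κ := fun b i => by
    rw [hw, abs_mul, abs_blockSign, mul_one, abs_of_pos hκ]
  have hu2 : ∀ j j', j ≠ j' → |(inner ℝ (u j) (u j') : ℝ)| = κ := by
    rintro (i | b) (i' | b') hjj
    · simp only [hu, Sum.elim_inl]
      rw [ha.inner_of_ne i i' fun h => hjj (h ▸ rfl), abs_of_pos hκ]
    · exact habsa b' i
    · simp only [hu, Sum.elim_inl, Sum.elim_inr]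
      rw [real_inner_comm]
      exact habsa b i'
    · exact habs b b.2 b' b'.2 fun h => hjj (by rw [Subtype.ext h])
  have he : IsEquiangular (linesThrough (Set.range u)) κ := isEquiangular_linesThrough_range hu1 hu2
  have hcard : (linesThrough (Set.range u)).encard = (d + B.card : ℕ) := by
    rw [encard_linesThrough_range_of_abs_inner_lt hu1 fun j j' h => (hu2 j j' h).trans_lt hκ1]
    simp
  have hfin : (linesThrough (Set.range u)).Finite := by
    rw [← Set.encard_lt_top_iff, hcard]
    exact ENat.natCast_lt_top _
  have hncard : (linesThrough (Set.range u)).ncard = d + B.card := by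
    rw [Set.ncard, hcard, ENat.toNat_natCast]
  refine ⟨linesThrough (Set.range u), he, ⟨?_, hfin, ?_⟩, hncard, ?_⟩
  · have h1 : κ ^ 2 * d < κ ^ 2 * ρ ^ 2 := mul_lt_mul_of_pos_left hlt (by positivity)
    rwa [← mul_pow, hκρ, one_pow] at h1
  · have hκ' : κ = ρ⁻¹ := eq_inv_of_mul_eq_one_left hκρ
    have h1 : ρ ^ 2 - d ≠ 0 := by linarith
    have h2 : 1 - κ ^ 2 * d = (ρ ^ 2 - d) / ρ ^ 2 := by
      rw [hκ']
      field_simp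
    rw [hncard, h2, hκ']
    push_cast
    field_simp
    linear_combination hB
  · refine ha.Inc_eq hκ hκ1 hκ hκ1 he hfin (linesThrough_subset_of_smul_mem ?_)
    rintro _ ⟨i, rfl⟩
    exact ⟨1, one_ne_zero, Sum.inl i, by simp [hu]⟩

theorem DesignCaseRoot.exists_lines {d : ℕ} (hd : 2 ≤ d) {κ ρ : ℝ} (hκ : 0 < κ)
    (hκρ : κ * ρ = 1) (h : DesignCaseRoot d ρ) :
    ∃ Ω : Set (Line d), IsEquiangular Ω κ ∧ SaturatesRelativeBound Ω κ ∧ Inc Ω = d := by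
  obtain ⟨k, lam, s₁, s₂, hroot, hlam, hs₁, hs₂, B, hB⟩ := h
  obtain ⟨b, hb, c, hc, hbc, hi₁⟩ := hB.exists_inter_fst
  obtain ⟨b', hb', c', hc', hbc', hi₂⟩ := hB.exists_inter_snd
  -- blocks with at most one point only meet in one way
  have hk : 2 ≤ k := by
    by_contra hlt
    have hzero : ∀ x ∈ B, ∀ y ∈ B, x ≠ y → (x ∩ y).card = 0 := by
      intro x hx y hy hxy
      by_contra hne
      obtain ⟨z, hz⟩ := Finset.card_pos.mp (Nat.pos_of_ne_zero hne)
      have hle : ∀ t ∈ B, t.card ≤ 1 := fun t ht => by rw [hB.card_block t ht]; omega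
      refine hxy (Finset.ext fun t => ⟨fun ht => ?_, fun ht => ?_⟩)
      · rw [Finset.card_le_one.mp (hle x hx) t ht z (Finset.mem_inter.mp hz).1]
        exact (Finset.mem_inter.mp hz).2
      · rw [Finset.card_le_one.mp (hle y hy) t ht z (Finset.mem_inter.mp hz).2]
        exact (Finset.mem_inter.mp hz).1
    exact hB.ne (by rw [← hi₁, ← hi₂, hzero b hb c hc hbc, hzero b' hb' c' hc' hbc'])
  have hlampos : 0 < lam := by
    obtain ⟨T, hTb, hT⟩ := Finset.exists_subset_card_eq (hk.trans_eq (hB.card_block b hb).symm)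
    rw [← hB.card_blocks_through T hT]
    exact Finset.card_pos.mpr ⟨b, Finset.mem_filter.mpr ⟨hb, hTb⟩⟩
  have hk' : (2 : ℝ) ≤ k := by exact_mod_cast hk
  have hkk : 0 < (k : ℝ) * (k - 1) := mul_pos (by linarith) (by linarith)
  have hpos : 0 < ρ ^ 2 - d := by
    have h1 : (0 : ℝ) < k * (k - 1) / (ρ ^ 2 - d) := by
      rw [← hlam]
      exact_mod_cast hlampos
    exact (div_pos_iff_of_pos_left hkk).mp h1
  obtain ⟨Ω, h1, h2, -, h3⟩ := exists_lines_of_blocks hd hκ hκρ (by linarith)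
    hB.card_block hroot (fun x hx y hy hxy => by
      rw [← hs₁, ← hs₂]
      exact_mod_cast hB.inter x hx y hy hxy)
    (by
      have h1 := hB.toIsDesign.card_mul
      rw [hlam, div_mul_eq_mul_div, eq_div_iff hpos.ne'] at h1
      apply mul_left_cancel₀ hkk.ne'
      linear_combination h1)
  exact ⟨Ω, h1, h2, h3⟩

theorem DesignCaseHalf.exists_lines {d n : ℕ} (hd : 2 ≤ d) {κ ρ : ℝ} (hκ : 0 < κ)
    (hκρ : κ * ρ = 1) (h : DesignCaseHalf d n ρ) :
    ∃ Ω : Set (Line d), IsEquiangular Ω κ ∧ SaturatesRelativeBound Ω κ ∧ Ω.ncard = n ∧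
      Inc Ω = d := by
  obtain ⟨i, hi, rfl, hdρ, hn, hdes⟩ := h
  have hi' : (1 : ℝ) ≤ i := by exact_mod_cast hi
  have hd1 : d = 2 * i * (2 * i + 1) - 1 + 1 := by
    have h1 : (d : ℝ) = (2 * i * (2 * i + 1) : ℕ) := by
      rw [hdρ]
      push_cast
      ring
    have h2 : d = 2 * i * (2 * i + 1) := by exact_mod_cast h1
    omega
  generalize 2 * i * (2 * i + 1) - 1 = m at hdes hd1
  subst hd1
  obtain ⟨B, hB⟩ := hdes
  have hm : (m : ℝ) = 2 * i * (2 * i + 1) - 1 := by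
    push_cast at hdρ
    linear_combination hdρ
  have hk : (((2 * i - 1) * (i + 1) : ℕ) : ℝ) = (2 * i - 1) * (i + 1) := by
    push_cast [Nat.cast_sub (by omega : 1 ≤ 2 * i)]
    ring
  have hlam : ((i * (2 * i ^ 2 + i - 2) : ℕ) : ℝ) = i * (2 * i ^ 2 + i - 2) := by
    have : 2 ≤ 2 * i ^ 2 + i := by nlinarith
    push_cast [Nat.cast_sub this]
    ring
  have hcard : (B.card : ℝ) = 2 * i * m := by
    have h1 := hB.toIsDesign.card_mul
    rw [hk, hlam, show (m : ℝ) * (m - 1) = m * (2 * ((2 * i - 1) * (i + 1))) by rw [hm]; ring]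
      at h1
    have h2 : (2 * (i : ℝ) - 1) * (i + 1) * (2 * i ^ 2 + i - 2) ≠ 0 := by
      have : 0 < 2 * (i : ℝ) - 1 := by linarith
      have : 0 < 2 * (i : ℝ) ^ 2 + i - 2 := by nlinarith
      positivity
    apply mul_left_cancel₀ h2
    linear_combination h1
  -- a new point is added to all the blocks
  let g : Finset (Fin m) → Finset (Fin (m + 1)) := fun b => insert 0 (b.map (Fin.succEmb m))
  have hgcard : ∀ b, (g b).card = b.card + 1 := fun b => by
    rw [Finset.card_insert_of_notMem (by simp [Fin.succ_ne_zero]), Finset.card_map]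
  have hginter : ∀ b c, g b ∩ g c = g (b ∩ c) := fun b c => by
    simp only [g, Finset.map_inter, Finset.insert_inter_distrib]
  have hginj : Function.Injective g := by
    intro b c hbc
    ext j
    have h1 : ∀ b, j.succ ∈ g b ↔ j ∈ b := fun b => by simp [g, Fin.succ_ne_zero]
    rw [← h1, hbc, h1]
  obtain ⟨Ω, h1, h2, h3, h4⟩ := exists_lines_of_blocks hd hκ hκρ (B := B.image g)
    (k := (2 * i - 1) * (i + 1) + 1)
    (by
      rw [hdρ]
      nlinarith)
    (fun x hx => by
      obtain ⟨b, hb, rfl⟩ := Finset.mem_image.mp hx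
      rw [hgcard, hB.card_block b hb])
    (by
      rw [Nat.cast_add, hk, hdρ]
      push_cast
      ring)
    (fun x hx y hy hxy => by
      obtain ⟨b, hb, rfl⟩ := Finset.mem_image.mp hx
      obtain ⟨c, hc, rfl⟩ := Finset.mem_image.mp hy
      rw [hginter, hgcard, Nat.cast_add (b ∩ c).card, Nat.cast_add ((2 * i - 1) * (i + 1)), hk]
      rcases hB.inter b hb c hc fun h => hxy (h ▸ rfl) with h | h
      · left
        rw [h]
        push_cast [Nat.cast_sub (by nlinarith : 1 ≤ i ^ 2 + i)]
        ring
      · right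
        rw [h]
        push_cast [Nat.cast_sub (by nlinarith : 1 ≤ i ^ 2)]
        ring)
    (by
      rw [Finset.card_image_of_injective _ hginj, hcard, hdρ, hm]
      ring)
  refine ⟨Ω, h1, h2, ?_, h4⟩
  rw [h3, Finset.card_image_of_injective _ hginj]
  have h5 : ((m + 1 + B.card : ℕ) : ℝ) = n := by
    rw [Nat.cast_add, hcard, hdρ, hn, hm]
    ring
  exact_mod_cast h5

theorem theorem3 (d : ℕ) (hd : 2 ≤ d) (κ ρ : ℝ) (hκ : 0 < κ) (hρ : ρ = κ⁻¹) :
    (∀ Ω : Set (Line d), IsEquiangular Ω κ → SaturatesRelativeBound Ω κ →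
      (Inc Ω = d →
        IsThreeLinesInPlane Ω ∨ IsSixLinesInSpace Ω ∨ DesignCaseHalf d Ω.ncard ρ ∨
          DesignCaseRoot d ρ) ∧
      (IsThreeLinesInPlane Ω ∨ IsSixLinesInSpace Ω → Inc Ω = d)) ∧
    (∀ n : ℕ, DesignCaseHalf d n ρ →
      ∃ Ω : Set (Line d), IsEquiangular Ω κ ∧ SaturatesRelativeBound Ω κ ∧ Ω.ncard = n ∧
        Inc Ω = d) ∧
    (DesignCaseRoot d ρ →
      ∃ Ω : Set (Line d), IsEquiangular Ω κ ∧ SaturatesRelativeBound Ω κ ∧ Inc Ω = d) := by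
  have hκρ : κ * ρ = 1 := by rw [hρ]; exact mul_inv_cancel₀ hκ.ne'
  refine ⟨fun Ω he hs => ⟨fun hinc => ?_, fun h => ?_⟩,
    fun n h => h.exists_lines hd hκ hκρ, fun h => h.exists_lines hd hκ hκρ⟩
  · obtain ⟨m, a, v, h, rfl, hcard⟩ := exists_isSaturatedExtension hd hκ hρ he hs hinc
    obtain rfl | rfl | hd4 : d = 2 ∨ d = 3 ∨ 4 ≤ d := by omega
    · exact Or.inl h.isThreeLinesInPlane
    · exact Or.inr (Or.inl h.isSixLinesInSpace)
    · have h4 := h.designCase hd4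
      rw [Fintype.card_fin, ← hcard] at h4
      exact Or.inr (Or.inr h4)
  · rcases h with h | h
    · exact h.Inc_eq hκ he hs
    · exact h.Inc_eq hκ he hs
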